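/- **Setting.** Let $d_l\ge 3$, $d_r\ge 2$, $\gamma\ge 2$ be integers. For $x:\mathbb Z\to[0,1]$ put $$g(x_{i-\gamma+1},\dots,x_{i+\gamma-1})=\Big(1-\frac1\gamma\sum_{j=0}^{\gamma-1}\Big(1-\frac1\gamma\sum_{k=0}^{\gamma-1}x_{i+j-k}\Big)^{d_r-1}\Big)^{d_l-1}.$$ For $\epsilon\in[0,1]$, $n\in\mathbb N$ and boundary values $b_i\in[0,1]$ ($i\notin\{1,\dots,n\}$), *forward density evolution* (DE) on the sections $1,\dots,n$ starts from $x_i^{(0)}=1$ for $1\le i\le n$, iterates $x_i^{(\ell)}=\epsilon\, g(x^{(\ell-1)}_{i-\gamma+1},\dots,x^{(\ell-1)}_{i+\gamma-1})$ for $1\le i\le n$, and keeps $x_i^{(\ell)}=b_i$ for all other $i$ and all $\ell\ge 0$. It converges pointwise, and the limit is called the fixed point (FP) of forward DE. * $\epsilon^{\mathrm{BP}}(d_l,d_r,\gamma,L)$ is the supremum of the $\epsilon\in[0,1]$ for which the FP with $n=L$ and $b\equiv0$ is identically $0$, and $\epsilon^{\mathrm{BP}}(d_l,d_r,\gamma)=\lim_{L\to\infty}\epsilon^{\mathrm{BP}}(d_l,d_r,\gamma,L)$.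 * $\epsilon^{\mathrm{BP}}(d_l,d_r)$ is the supremum of the $\epsilon\in[0,1]$ for which the sequence $x^{(0)}=1$, $x^{(\ell)}=\epsilon\big(1-(1-x^{(\ell-1)})^{d_r-1}\big)^{d_l-1}$ tends to $0$. * The *first window configuration FP* $y=(y_i)$ for window size $W$ and erasure rate $\epsilon$ is the FP with $n=W$, $b_i=0$ for $i\le 0$ and $b_i=1$ for $i>W$. Its *transition width* is $\tau(\epsilon,\delta)=|\{i\in\{1,\dots,W\}:\delta<y_i\le 1\}|$. * $\epsilon^{\mathrm{FW}}(d_l,d_r,\gamma,W,\delta)$ is the supremum of the $\epsilon\in[0,1]$ for which the first window configuration FP for window size $W$ satisfies $y_1\le\delta$. * $\delta_0=\big((d_r-1)^{\frac{d_l-1}{d_l-2}}\big)^{-1}$. **Proposition (Maximum Transition Width).** There are constants $\mathsf A,\mathsf B,\hat{\mathsf C}>0$ and $\mathsf D>\delta_0$, depending only on $d_l,d_r,\gamma$, such that the following holds. 1. For every window size $W$, every $\delta\in(0,\delta_0]$ and every $\epsilon\in\Big[\frac{\epsilon^{\mathrm{BP}}(d_l,d_r,\gamma)+\epsilon^{\mathrm{BP}}(d_l,d_r)}2,\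 \epsilon^{\mathrm{BP}}(d_l,d_r,\gamma)\Big)$, with $\Delta\epsilon=\epsilon^{\mathrm{BP}}(d_l,d_r,\gamma)-\epsilon$, $$\tau(\epsilon,\delta)\le(\gamma-1)\Big(\mathsf A\ln\ln\frac{\mathsf D}{\delta}+\mathsf B\ln\frac1{\Delta\epsilon}+\hat{\mathsf C}\Big).$$ 2. Suppose $\Delta\epsilon_{\max}:=\frac{\epsilon^{\mathrm{BP}}(d_l,d_r,\gamma)-\epsilon^{\mathrm{BP}}(d_l,d_r)}2>0$ (that is, the interval in part 1 is non-empty). For every $\delta\in(0,\delta_0]$ and every $$W\ge\hat W_{\min}(\delta)=\Big\lfloor(\gamma-1)\Big(\mathsf A\ln\ln\frac{\mathsf D}{\delta}+\mathsf B\ln\frac1{\Delta\epsilon_{\max}}+\hat{\mathsf C}\Big)\Big\rfloor+1,$$ one has $$\epsilon^{\mathrm{FW}}(d_l,d_r,\gamma,W,\delta)\ \ge\ \epsilon^{\mathrm{BP}}(d_l,d_r,\gamma)-\exp\Big(-\frac1{\mathsf B}\Big(\frac W{\gamma-1}-\mathsf A\ln\ln\frac{\mathsf D}{\delta}-\hat{\mathsf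 C}\Big)\Big).$$ -/

import Mathlib

open Filter Topology

namespace SpatialCoupling

noncomputable section

/-- The function `g` of density evolution for the `(dl, dr, γ)` spatially coupled ensemble, at
section `i` of a constellation `x : ℤ → ℝ`. It only reads `x (i - γ + 1), …, x (i + γ - 1)`. -/
def coupledG (dl dr γ : ℕ) (x : ℤ → ℝ) (i : ℤ) : ℝ :=
  (1 - (1 / (γ : ℝ)) * ∑ j ∈ Finset.range γ,
    (1 - (1 / (γ : ℝ)) * ∑ k ∈ Finset.range γ, x (i + (j : ℤ) - (k : ℤ))) ^ (dr - 1)) ^ (dl - 1)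

/-- Forward density evolution (parallel schedule) at channel erasure rate `ε` on the sections
`1, …, n`, where every section `i` outside `1, …, n` is held at the boundary value `b i`:
the value of section `i` after `ℓ` iterations. The sections `1, …, n` start at `1`. -/
def chainDE (dl dr γ : ℕ) (ε : ℝ) (n : ℕ) (b : ℤ → ℝ) : ℕ → ℤ → ℝ
  | 0 => fun i => if 1 ≤ i ∧ i ≤ (n : ℤ) then 1 else b i
  | ℓ + 1 => fun i =>
      if 1 ≤ i ∧ i ≤ (n : ℤ) then ε * coupledG dl dr γ (chainDE dl dr γ ε n b ℓ) i else b i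

/-- The fixed point of forward density evolution, i.e. the pointwise limit of the iterations
(the limit exists: see `tendsto_chainDE`). -/
def chainFP (dl dr γ : ℕ) (ε : ℝ) (n : ℕ) (b : ℤ → ℝ) (i : ℤ) : ℝ :=
  limUnder atTop (fun ℓ : ℕ => chainDE dl dr γ ε n b ℓ i)

/-- Fixed point of BP forward density evolution for the chain of length `L`: all sections outside
`1, …, L` are `0`. -/
def bpFP (dl dr γ : ℕ) (ε : ℝ) (L : ℕ) : ℤ → ℝ :=
  chainFP dl dr γ ε L (fun _ => 0)

/-- The BP threshold `ε^BP(dl, dr, γ, L)`. -/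
def bpThresholdChain (dl dr γ L : ℕ) : ℝ :=
  sSup {ε : ℝ | 0 ≤ ε ∧ ε ≤ 1 ∧ ∀ i : ℤ, bpFP dl dr γ ε L i = 0}

/-- The BP threshold `ε^BP(dl, dr, γ) = lim_{L → ∞} ε^BP(dl, dr, γ, L)`
(the limit exists: see `tendsto_bpThresholdChain`). -/
def bpThresholdCoupled (dl dr γ : ℕ) : ℝ :=
  limUnder atTop (fun L : ℕ => bpThresholdChain dl dr γ L)

/-- Forward density evolution for the uncoupled `(dl, dr)`-regular ensemble, started at `1`. -/
def regularDE (dl dr : ℕ) (ε : ℝ) : ℕ → ℝ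
  | 0 => 1
  | ℓ + 1 => ε * (1 - (1 - regularDE dl dr ε ℓ) ^ (dr - 1)) ^ (dl - 1)

/-- The BP threshold `ε^BP(dl, dr)` of the uncoupled `(dl, dr)`-regular ensemble: the supremum of
the erasure rates for which density evolution converges to `0`. -/
def bpThresholdRegular (dl dr : ℕ) : ℝ :=
  sSup {ε : ℝ | 0 ≤ ε ∧ ε ≤ 1 ∧ Tendsto (regularDE dl dr ε) atTop (𝓝 0)}

/-- The first window configuration fixed point for a window of size `W`: sections `i ≤ 0` are held
at `0`, sections `i > W` are held at `1`. -/
def fwFP (dl dr γ : ℕ) (ε : ℝ) (W : ℕ) : ℤ → ℝ :=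
  chainFP dl dr γ ε W (fun i => if i ≤ 0 then 0 else 1)

/-- The transition width `τ(ε, δ)` of the first window configuration fixed point. -/
def transitionWidth (dl dr γ : ℕ) (ε : ℝ) (W : ℕ) (δ : ℝ) : ℕ :=
  Set.ncard {i : ℤ | (1 ≤ i ∧ i ≤ (W : ℤ)) ∧ δ < fwFP dl dr γ ε W i ∧ fwFP dl dr γ ε W i ≤ 1}

/-- The first window threshold `ε^FW(dl, dr, γ, W, δ)`. -/
def fwThreshold (dl dr γ W : ℕ) (δ : ℝ) : ℝ :=
  sSup {ε : ℝ | 0 ≤ ε ∧ ε ≤ 1 ∧ fwFP dl dr γ ε W 1 ≤ δ}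

/-- `δ₀ = ((dr - 1) ^ ((dl - 1) / (dl - 2)))⁻¹`. -/
def deltaZero (dl dr : ℕ) : ℝ :=
  (((dr : ℝ) - 1) ^ (((dl : ℝ) - 1) / ((dl : ℝ) - 2)))⁻¹

/-- The expression `(γ - 1) (A ln ln (D / δ) + B ln (1 / Δ) + C)`. -/
def widthBound (γ : ℕ) (A B C D δ Δ : ℝ) : ℝ :=
  ((γ : ℝ) - 1) * (A * Real.log (Real.log (D / δ)) + B * Real.log (1 / Δ) + C)

/-! The limits in the definitions above exist. -/

theorem avg_mem (γ : ℕ) {x : ℕ → ℝ} (hx : ∀ k, 0 ≤ x k ∧ x k ≤ 1) :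
    0 ≤ (1 / (γ : ℝ)) * ∑ k ∈ Finset.range γ, x k ∧
      (1 / (γ : ℝ)) * ∑ k ∈ Finset.range γ, x k ≤ 1 := by
  refine ⟨mul_nonneg (by positivity) (Finset.sum_nonneg fun k _ => (hx k).1), ?_⟩
  have h : ∑ k ∈ Finset.range γ, x k ≤ γ := by
    simpa using Finset.sum_le_card_nsmul (Finset.range γ) x 1 fun k _ => (hx k).2
  rw [one_div_mul_eq_div]
  exact div_le_one_of_le₀ h (Nat.cast_nonneg γ)

theorem inner_mem (dr γ : ℕ) {x : ℤ → ℝ} (hx : ∀ i, 0 ≤ x i ∧ x i ≤ 1) (i : ℤ) (j : ℕ) :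
    0 ≤ (1 - (1 / (γ : ℝ)) * ∑ k ∈ Finset.range γ, x (i + (j : ℤ) - (k : ℤ))) ^ (dr - 1) ∧
      (1 - (1 / (γ : ℝ)) * ∑ k ∈ Finset.range γ, x (i + (j : ℤ) - (k : ℤ))) ^ (dr - 1) ≤ 1 := by
  have h := avg_mem γ (x := fun k => x (i + (j : ℤ) - (k : ℤ))) fun k => hx _
  exact ⟨pow_nonneg (by linarith [h.2]) _, pow_le_one₀ (by linarith [h.2]) (by linarith [h.1])⟩

theorem coupledG_mem (dl dr γ : ℕ) {x : ℤ → ℝ} (hx : ∀ i, 0 ≤ x i ∧ x i ≤ 1) (i : ℤ) :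
    0 ≤ coupledG dl dr γ x i ∧ coupledG dl dr γ x i ≤ 1 := by
  have h := avg_mem γ fun j => inner_mem dr γ hx i j
  exact ⟨pow_nonneg (by linarith [h.2]) _, pow_le_one₀ (by linarith [h.2]) (by linarith [h.1])⟩

theorem coupledG_mono (dl dr γ : ℕ) {x y : ℤ → ℝ} (hx : ∀ i, 0 ≤ x i ∧ x i ≤ 1)
    (hy : ∀ i, 0 ≤ y i ∧ y i ≤ 1) (hxy : ∀ i, x i ≤ y i) (i : ℤ) :
    coupledG dl dr γ x i ≤ coupledG dl dr γ y i := by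
  have h := avg_mem γ fun j => inner_mem dr γ hx i j
  refine pow_le_pow_left₀ (by linarith [h.2]) (sub_le_sub_left ?_ _) _
  refine mul_le_mul_of_nonneg_left (Finset.sum_le_sum fun j _ => ?_) (by positivity)
  have h' := avg_mem γ (x := fun k => y (i + (j : ℤ) - (k : ℤ))) fun k => hy _
  refine pow_le_pow_left₀ (by linarith [h'.2]) (sub_le_sub_left ?_ _) _
  exact mul_le_mul_of_nonneg_left (Finset.sum_le_sum fun k _ => hxy _) (by positivity)

theorem chainDE_mem (dl dr γ : ℕ) {ε : ℝ} (hε : 0 ≤ ε ∧ ε ≤ 1) (n : ℕ) {b : ℤ → ℝ}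
    (hb : ∀ i, 0 ≤ b i ∧ b i ≤ 1) (ℓ : ℕ) (i : ℤ) :
    0 ≤ chainDE dl dr γ ε n b ℓ i ∧ chainDE dl dr γ ε n b ℓ i ≤ 1 := by
  induction ℓ generalizing i with
  | zero =>
    simp only [chainDE]
    split_ifs
    · norm_num
    · exact hb i
  | succ ℓ ih =>
    simp only [chainDE]
    split_ifs
    · have h := coupledG_mem dl dr γ ih i
      exact ⟨mul_nonneg hε.1 h.1, mul_le_one₀ hε.2 h.1 h.2⟩
    · exact hb i

theorem chainDE_succ_le (dl dr γ : ℕ) {ε : ℝ} (hε : 0 ≤ ε ∧ ε ≤ 1) (n : ℕ) {b : ℤ → ℝ}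
    (hb : ∀ i, 0 ≤ b i ∧ b i ≤ 1) (ℓ : ℕ) (i : ℤ) :
    chainDE dl dr γ ε n b (ℓ + 1) i ≤ chainDE dl dr γ ε n b ℓ i := by
  induction ℓ generalizing i with
  | zero =>
    by_cases h : 1 ≤ i ∧ i ≤ (n : ℤ)
    · have h1 := (chainDE_mem dl dr γ hε n hb (0 + 1) i).2
      simpa only [chainDE, if_pos h] using h1
    · simp only [chainDE, if_neg h, le_refl]
  | succ ℓ ih =>
    by_cases h : 1 ≤ i ∧ i ≤ (n : ℤ)
    · rw [chainDE, chainDE]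
      simp only [if_pos h]
      exact mul_le_mul_of_nonneg_left (coupledG_mono dl dr γ
        (chainDE_mem dl dr γ hε n hb (ℓ + 1)) (chainDE_mem dl dr γ hε n hb ℓ) ih i) hε.1
    · simp only [chainDE, if_neg h, le_refl]

theorem tendsto_chainDE (dl dr γ : ℕ) {ε : ℝ} (hε : 0 ≤ ε ∧ ε ≤ 1) (n : ℕ) {b : ℤ → ℝ}
    (hb : ∀ i, 0 ≤ b i ∧ b i ≤ 1) (i : ℤ) :
    Tendsto (fun ℓ : ℕ => chainDE dl dr γ ε n b ℓ i) atTop (𝓝 (chainFP dl dr γ ε n b i)) := by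
  refine tendsto_nhds_limUnder ⟨_, tendsto_atTop_ciInf
    (antitone_nat_of_succ_le fun ℓ => chainDE_succ_le dl dr γ hε n hb ℓ i) ⟨0, ?_⟩⟩
  rintro _ ⟨ℓ, rfl⟩
  exact (chainDE_mem dl dr γ hε n hb ℓ i).1

theorem chainDE_zero_mono (dl dr γ : ℕ) {ε : ℝ} (hε : 0 ≤ ε ∧ ε ≤ 1) {m n : ℕ} (hmn : m ≤ n)
    (ℓ : ℕ) (i : ℤ) :
    chainDE dl dr γ ε m (fun _ => 0) ℓ i ≤ chainDE dl dr γ ε n (fun _ => 0) ℓ i := by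
  have hb : ∀ i : ℤ, 0 ≤ (fun _ : ℤ => (0 : ℝ)) i ∧ (fun _ : ℤ => (0 : ℝ)) i ≤ 1 :=
    fun _ => ⟨le_refl _, zero_le_one⟩
  induction ℓ generalizing i with
  | zero =>
    by_cases h : 1 ≤ i ∧ i ≤ (m : ℤ)
    · have h' : 1 ≤ i ∧ i ≤ (n : ℤ) := ⟨h.1, by omega⟩
      simp only [chainDE, if_pos h, if_pos h', le_refl]
    · have h0 := (chainDE_mem dl dr γ hε n hb 0 i).1
      simpa only [chainDE, if_neg h] using h0
  | succ ℓ ih =>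
    by_cases h : 1 ≤ i ∧ i ≤ (m : ℤ)
    · have h' : 1 ≤ i ∧ i ≤ (n : ℤ) := ⟨h.1, by omega⟩
      simp only [chainDE, if_pos h, if_pos h']
      exact mul_le_mul_of_nonneg_left (coupledG_mono dl dr γ
        (chainDE_mem dl dr γ hε m hb ℓ) (chainDE_mem dl dr γ hε n hb ℓ) ih i) hε.1
    · have h0 := (chainDE_mem dl dr γ hε n hb (ℓ + 1) i).1
      simpa only [chainDE, if_neg h] using h0

theorem bpFP_zero (dl dr γ L : ℕ) (i : ℤ) : bpFP dl dr γ 0 L i = 0 := by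
  refine Tendsto.limUnder_eq (tendsto_const_nhds.congr' ?_)
  filter_upwards [eventually_ge_atTop 1] with ℓ hℓ
  obtain ⟨k, rfl⟩ : ∃ k, ℓ = k + 1 := ⟨ℓ - 1, by omega⟩
  simp [chainDE]

theorem bpThresholdChain_antitone (dl dr γ : ℕ) : Antitone (bpThresholdChain dl dr γ) := by
  intro m n hmn
  have hb : ∀ i : ℤ, 0 ≤ (fun _ : ℤ => (0 : ℝ)) i ∧ (fun _ : ℤ => (0 : ℝ)) i ≤ 1 :=
    fun _ => ⟨le_refl _, zero_le_one⟩
  refine csSup_le_csSup ⟨1, fun ε h => h.2.1⟩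
    ⟨0, le_refl _, zero_le_one, bpFP_zero dl dr γ n⟩ ?_
  rintro ε ⟨h0, h1, hz⟩
  refine ⟨h0, h1, fun i => le_antisymm ?_ ?_⟩
  · rw [← hz i]
    exact le_of_tendsto_of_tendsto' (tendsto_chainDE dl dr γ ⟨h0, h1⟩ m hb i)
      (tendsto_chainDE dl dr γ ⟨h0, h1⟩ n hb i) fun ℓ => chainDE_zero_mono dl dr γ ⟨h0, h1⟩ hmn ℓ i
  · exact ge_of_tendsto' (tendsto_chainDE dl dr γ ⟨h0, h1⟩ m hb i)
      fun ℓ => (chainDE_mem dl dr γ ⟨h0, h1⟩ m hb ℓ i).1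

theorem tendsto_bpThresholdChain (dl dr γ : ℕ) :
    Tendsto (fun L : ℕ => bpThresholdChain dl dr γ L) atTop
      (𝓝 (bpThresholdCoupled dl dr γ)) := by
  refine tendsto_nhds_limUnder ⟨_, tendsto_atTop_ciInf (bpThresholdChain_antitone dl dr γ) ⟨0, ?_⟩⟩
  rintro _ ⟨L, rfl⟩
  exact Real.sSup_nonneg fun ε h => h.1

end

end SpatialCoupling

/-! The window fixed point `y` increases from 0 to 1, so the sections with value in (δ, 1] can be
counted separately over five ranges of values: up to β = δ₀/2, from β to p, at p, from p to α, and
from α on. Here f(x) = ε(1 - (1 - x)^(dr-1))^(dl-1) is the uncoupled map, p is a fixed point of f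
around which f expands, and α is a level above which f contracts, both in the coordinate log x.
Concavity of log f in log x (`concaveOn_log_checkFn_exp`) turns one chord slope into each of these
statements. The rates considered stay a fixed distance above the uncoupled threshold, so α and the
expansion and contraction factors do not depend on ε.

Low values: γ - 1 steps to the left cost at least one application of x ↦ ((dr-1)x)^(dl-1), whose
fixed point is δ₀. The decay is doubly exponential, whence ln ln (`width_tail`).

Near p: a suitable distance of `y` from p dominates a multiple κ > 1 of its own double window
average. A positive monotone sequence can do so only on a bounded stretch
(`length_le_of_mul_mean_le`).

High values: the increments of log y decay geometrically away from the ends of the stretch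
(`log_succ_sub_log_le`). They cannot become too small, however: reflecting a flat `y` at a section
would give a nonzero compactly supported subsolution below the coupled threshold
(`IsWindowFP.mul_pow_le`). Comparing the two bounds gives a length of order ln(1/Δε). The same lemma
excludes a long plateau at p.

For the threshold bound, a width below W forces y₁ ≤ δ, and the width bound is solved for Δε. -/

namespace SpatialCoupling

/-! ### Averages over a window of length `γ` -/

/-- The average of `f 0, …, f (γ - 1)`. -/
noncomputable def mean (γ : ℕ) (f : ℕ → ℝ) : ℝ := (1 / (γ : ℝ)) * ∑ k ∈ Finset.range γ, f k

theorem mean_mono {γ : ℕ} {f g : ℕ → ℝ} (h : ∀ k < γ, f k ≤ g k) : mean γ f ≤ mean γ g :=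
  mul_le_mul_of_nonneg_left (Finset.sum_le_sum fun k hk => h k (Finset.mem_range.1 hk))
    (by positivity)

theorem mean_const {γ : ℕ} (hγ : 0 < γ) (c : ℝ) : mean γ (fun _ => c) = c := by
  have : (γ : ℝ) ≠ 0 := by positivity
  simp [mean, this]

theorem mean_congr {γ : ℕ} {f g : ℕ → ℝ} (h : ∀ k < γ, f k = g k) : mean γ f = mean γ g :=
  le_antisymm (mean_mono fun k hk => (h k hk).le) (mean_mono fun k hk => (h k hk).ge)

theorem mean_const_mul (γ : ℕ) (c : ℝ) (f : ℕ → ℝ) :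
    mean γ (fun k => c * f k) = c * mean γ f := by
  simp only [mean, ← Finset.mul_sum]; ring

theorem mean_add (γ : ℕ) (f g : ℕ → ℝ) :
    mean γ (fun k => f k + g k) = mean γ f + mean γ g := by
  simp only [mean, Finset.sum_add_distrib]; ring

theorem mean_const_sub {γ : ℕ} (hγ : 0 < γ) (c : ℝ) (f : ℕ → ℝ) :
    mean γ (fun k => c - f k) = c - mean γ f := by
  have h := mean_add γ (fun k => c - f k) f
  simp only [sub_add_cancel, mean_const hγ] at h
  linarith

theorem le_mean {γ : ℕ} (hγ : 0 < γ) {c : ℝ} {f : ℕ → ℝ} (h : ∀ k < γ, c ≤ f k) :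
    c ≤ mean γ f := by
  simpa [mean_const hγ] using mean_mono (f := fun _ => c) h

theorem mean_le {γ : ℕ} (hγ : 0 < γ) {c : ℝ} {f : ℕ → ℝ} (h : ∀ k < γ, f k ≤ c) :
    mean γ f ≤ c := by
  simpa [mean_const hγ] using mean_mono (g := fun _ => c) h

theorem mean_reflect (γ : ℕ) (f : ℕ → ℝ) : mean γ (fun k => f (γ - 1 - k)) = mean γ f := by
  simp only [mean, Finset.sum_range_reflect]

/-- Jensen for the logarithm, obtained by averaging its tangent line at the mean. -/
theorem mean_log_le {γ : ℕ} (hγ : 0 < γ) {f : ℕ → ℝ} {c : ℝ} (hc : 0 < c)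
    (hf : ∀ k < γ, c ≤ f k) : mean γ (fun k => Real.log (f k)) ≤ Real.log (mean γ f) := by
  have hm : 0 < mean γ f := hc.trans_le (le_mean hγ hf)
  have h1 : mean γ (fun k => Real.log (f k)) ≤
      mean γ (fun k => (Real.log (mean γ f) - 1) + (mean γ f)⁻¹ * f k) := by
    refine mean_mono fun k hk => ?_
    have hk0 : 0 < f k := hc.trans_le (hf k hk)
    have h2 := Real.log_le_sub_one_of_pos (mul_pos (inv_pos.2 hm) hk0)
    rw [Real.log_mul (inv_pos.2 hm).ne' hk0.ne', Real.log_inv] at h2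
    linarith
  rw [mean_add, mean_const hγ, mean_const_mul, inv_mul_cancel₀ hm.ne'] at h1
  linarith

theorem mean_pow_le {γ : ℕ} (hγ : 0 < γ) {f : ℕ → ℝ} (hf : ∀ k < γ, 0 ≤ f k) (n : ℕ) :
    (mean γ f) ^ n ≤ mean γ (fun k => f k ^ n) := by
  have h := Real.pow_arith_mean_le_arith_mean_pow (Finset.range γ) (fun _ => 1 / (γ : ℝ)) f
    (fun _ _ => by positivity) (by simp [(by positivity : (γ : ℝ) ≠ 0)])
    (fun k hk => hf k (Finset.mem_range.1 hk)) n
  simpa only [mean, Finset.mul_sum] using h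

/-! ### The check node function -/

/-- `x ↦ 1 - (1 - x) ^ n`. -/
def checkFn (n : ℕ) (x : ℝ) : ℝ := 1 - (1 - x) ^ n

theorem checkFn_mono (n : ℕ) {x y : ℝ} (hy : y ≤ 1) (hxy : x ≤ y) :
    checkFn n x ≤ checkFn n y :=
  sub_le_sub_left (pow_le_pow_left₀ (by linarith) (by linarith) n) 1

theorem checkFn_nonneg (n : ℕ) {x : ℝ} (h0 : 0 ≤ x) (h1 : x ≤ 1) : 0 ≤ checkFn n x :=
  sub_nonneg.2 (pow_le_one₀ (by linarith) (by linarith))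

theorem checkFn_le_one (n : ℕ) {x : ℝ} (h1 : x ≤ 1) : checkFn n x ≤ 1 :=
  sub_le_self 1 (pow_nonneg (by linarith) n)

theorem checkFn_pos {n : ℕ} (hn : 1 ≤ n) {x : ℝ} (h0 : 0 < x) (h1 : x ≤ 1) :
    0 < checkFn n x :=
  sub_pos.2 (pow_lt_one₀ (by linarith) (by linarith) (by omega))

theorem checkFn_le_mul (n : ℕ) {x : ℝ} (h1 : x ≤ 1) : checkFn n x ≤ n * x := by
  have h := one_add_mul_le_pow (a := -x) (by linarith) n
  rw [checkFn, sub_eq_add_neg 1 x]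
  linarith

theorem mul_checkFn_le (n : ℕ) {θ x : ℝ} (hθ0 : 0 ≤ θ) (hθ1 : θ ≤ 1) (h1 : x ≤ 1) :
    θ * checkFn n x ≤ checkFn n (θ * x) := by
  have h := (convexOn_pow (𝕜 := ℝ) n).2 (Set.mem_Ici.2 zero_le_one)
    (Set.mem_Ici.2 (sub_nonneg.2 h1)) (sub_nonneg.2 hθ1) hθ0 (sub_add_cancel 1 θ)
  simp only [smul_eq_mul, one_pow, mul_one] at h
  have h2 : 1 - θ + θ * (1 - x) = 1 - θ * x := by ring
  rw [h2] at h
  simp only [checkFn]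
  linarith

theorem mean_checkFn_le {γ : ℕ} (hγ : 0 < γ) (n : ℕ) {f : ℕ → ℝ} (hf : ∀ k < γ, f k ≤ 1) :
    mean γ (fun k => checkFn n (f k)) ≤ checkFn n (mean γ f) := by
  have h := mean_pow_le hγ (f := fun k => 1 - f k) (fun k hk => by linarith [hf k hk]) n
  simp only [mean_const_sub hγ] at h
  simp only [checkFn, mean_const_sub hγ]
  linarith

theorem continuous_checkFn (n : ℕ) : Continuous (checkFn n) := by
  unfold checkFn; fun_prop

/-- The logarithm of `checkFn n` is a concave function of the logarithm of its argument. -/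
theorem concaveOn_log_checkFn_exp {n : ℕ} (hn : 1 ≤ n) :
    ConcaveOn ℝ (Set.Iic 0) (fun v => Real.log (checkFn n (Real.exp v))) := by
  have hpos : ∀ v ≤ (0 : ℝ), 0 < checkFn n (Real.exp v) := fun v hv =>
    checkFn_pos hn (Real.exp_pos v) (Real.exp_le_one_iff.2 hv)
  have hder : ∀ v < (0 : ℝ), HasDerivAt (fun v => Real.log (checkFn n (Real.exp v)))
      (n * (1 - Real.exp v) ^ (n - 1) * Real.exp v / checkFn n (Real.exp v)) v := by
    intro v hv
    have h1 : HasDerivAt (fun v => checkFn n (Real.exp v))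
        (n * (1 - Real.exp v) ^ (n - 1) * Real.exp v) v := by
      have := (((Real.hasDerivAt_exp v).const_sub 1).pow n).const_sub 1
      exact this.congr_deriv (by ring)
    exact h1.log (hpos v hv.le).ne'
  refine AntitoneOn.concaveOn_of_deriv (convex_Iic 0) ?_ ?_ ?_
  · exact ContinuousOn.log ((continuous_checkFn n).comp Real.continuous_exp).continuousOn
      fun v hv => (hpos v hv).ne'
  · rw [interior_Iic]
    exact fun v hv => (hder v hv).differentiableAt.differentiableWithinAt
  · rw [interior_Iic]
    intro v hv w hw hvw
    rw [(hder v hv).deriv, (hder w hw).deriv]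
    -- Factoring 1 - (1 - e^v)^n as a geometric sum cancels e^v; every term left in the denominator
    -- increases with v, so the derivative decreases.
    have key : ∀ v < (0 : ℝ), n * (1 - Real.exp v) ^ (n - 1) * Real.exp v / checkFn n (Real.exp v)
        = n / ∑ k ∈ Finset.range n, ((1 - Real.exp v)⁻¹) ^ k := by
      intro v hv
      have he : Real.exp v < 1 := Real.exp_lt_one_iff.2 hv
      have ht : 0 < 1 - Real.exp v := by linarith
      have hs : 0 < ∑ k ∈ Finset.range n, ((1 - Real.exp v)⁻¹) ^ k :=
        Finset.sum_pos (fun k _ => by positivity) ⟨0, Finset.mem_range.2 hn⟩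
      rw [div_eq_div_iff (hpos v hv.le).ne' hs.ne']
      have hg : (∑ k ∈ Finset.range n, ((1 - Real.exp v)⁻¹) ^ k) * (1 - Real.exp v) ^ (n - 1) =
          ∑ k ∈ Finset.range n, (1 - Real.exp v) ^ k := by
        rw [← Finset.sum_range_reflect (fun k => (1 - Real.exp v) ^ k), Finset.sum_mul]
        refine Finset.sum_congr rfl fun k hk => ?_
        have hk' := Finset.mem_range.1 hk
        rw [inv_pow, inv_mul_eq_div, div_eq_iff (by positivity), ← pow_add]
        congr 1; omega
      have hgeom := mul_neg_geom_sum (1 - Real.exp v) n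
      rw [sub_sub_cancel] at hgeom
      rw [checkFn, ← hgeom, ← hg]
      ring
    rw [key v hv, key w hw]
    have hv1 : Real.exp v < 1 := Real.exp_lt_one_iff.2 hv
    have hw1 : Real.exp w < 1 := Real.exp_lt_one_iff.2 hw
    have hvw' := Real.exp_le_exp.2 hvw
    have htv : 0 < 1 - Real.exp v := by linarith
    have htw : 0 < 1 - Real.exp w := by linarith
    refine div_le_div_of_nonneg_left (by positivity)
      (Finset.sum_pos (fun k _ => by positivity) ⟨0, Finset.mem_range.2 hn⟩)
      (Finset.sum_le_sum fun k _ => ?_)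
    gcongr

/-- Slopes of `log ∘ checkFn n` with respect to the logarithm are decreasing. -/
theorem log_checkFn_slope {n : ℕ} (hn : 1 ≤ n) {a b c : ℝ} (ha : 0 < a) (hab : a < b)
    (hbc : b < c) (hc : c ≤ 1) :
    (Real.log (checkFn n c) - Real.log (checkFn n b)) / (Real.log c - Real.log b) ≤
      (Real.log (checkFn n b) - Real.log (checkFn n a)) / (Real.log b - Real.log a) := by
  have hb : 0 < b := ha.trans hab
  have hc0 : 0 < c := hb.trans hbc
  have h := (concaveOn_log_checkFn_exp hn).slope_anti_adjacent
    (x := Real.log a) (y := Real.log b) (z := Real.log c)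
    (Real.log_nonpos ha.le (by linarith)) (Real.log_nonpos hc0.le hc)
    (Real.log_lt_log ha hab) (Real.log_lt_log hb hbc)
  simpa only [Real.exp_log ha, Real.exp_log hb, Real.exp_log hc0] using h

/-! ### The coupled recursion -/

theorem coupledG_eq (dl dr : ℕ) {γ : ℕ} (hγ : 0 < γ) (x : ℤ → ℝ) (i : ℤ) :
    coupledG dl dr γ x i = (mean γ fun j => checkFn (dr - 1)
      (mean γ fun k => x (i + (j : ℤ) - (k : ℤ)))) ^ (dl - 1) := by
  simp only [checkFn, mean_const_sub hγ]
  rfl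

theorem coupledG_shift (dl dr γ : ℕ) (x : ℤ → ℝ) (d i : ℤ) :
    coupledG dl dr γ (fun j => x (j + d)) i = coupledG dl dr γ x (i + d) := by
  simp only [coupledG]
  congr 4; ext j; congr 4; ext k; congr 1; ring

/-- Reversing both averages, j ↦ γ-1-j and k ↦ γ-1-k, leaves i + j - k symmetric about i. -/
theorem coupledG_reflect (dl dr : ℕ) {γ : ℕ} (hγ : 0 < γ) (x : ℤ → ℝ) (c i : ℤ) :
    coupledG dl dr γ (fun j => x (c - j)) i = coupledG dl dr γ x (c - i) := by
  rw [coupledG_eq _ _ hγ, coupledG_eq _ _ hγ, ← mean_reflect]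
  congr 1
  refine mean_congr fun j hj => ?_
  rw [← mean_reflect]
  congr 1
  refine mean_congr fun k hk => ?_
  congr 1
  omega

/-- If `x` dominates `θ y` in the window of section `i`, then `g x` dominates
`θ ^ (dl - 1) g y` at `i`. -/
theorem mul_coupledG_le (dl dr : ℕ) {γ : ℕ} (hγ : 0 < γ) {x y : ℤ → ℝ} {θ : ℝ} {i : ℤ}
    (hθ0 : 0 ≤ θ) (hθ1 : θ ≤ 1) (hx : ∀ j, x j ≤ 1) (hy : ∀ j, 0 ≤ y j ∧ y j ≤ 1)
    (h : ∀ j, i - γ < j → j < i + γ → θ * y j ≤ x j) :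
    θ ^ (dl - 1) * coupledG dl dr γ y i ≤ coupledG dl dr γ x i := by
  rw [coupledG_eq _ _ hγ, coupledG_eq _ _ hγ, ← mul_pow, ← mean_const_mul]
  have h0 : ∀ j : ℕ, 0 ≤ mean γ fun k => y (i + (j : ℤ) - (k : ℤ)) :=
    fun j => le_mean hγ fun k _ => (hy _).1
  have h1 : ∀ j : ℕ, (mean γ fun k => y (i + (j : ℤ) - (k : ℤ))) ≤ 1 :=
    fun j => mean_le hγ fun k _ => (hy _).2
  refine pow_le_pow_left₀ (le_mean hγ fun j _ =>
    mul_nonneg hθ0 (checkFn_nonneg _ (h0 j) (h1 j))) (mean_mono fun j hj => ?_) _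
  refine (mul_checkFn_le _ hθ0 hθ1 (h1 j)).trans
    (checkFn_mono _ (mean_le hγ fun k _ => hx _) ?_)
  rw [← mean_const_mul]
  exact mean_mono fun k hk => h _ (by omega) (by omega)

/-! ### Fixed points of forward density evolution -/

theorem tendsto_coupledG (dl dr γ : ℕ) {x : ℕ → ℤ → ℝ} {y : ℤ → ℝ}
    (h : ∀ i, Tendsto (fun ℓ => x ℓ i) atTop (𝓝 (y i))) (i : ℤ) :
    Tendsto (fun ℓ => coupledG dl dr γ (x ℓ) i) atTop (𝓝 (coupledG dl dr γ y i)) := by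
  unfold coupledG
  refine Tendsto.pow (tendsto_const_nhds.sub (tendsto_const_nhds.mul
    (tendsto_finsetSum _ fun j _ => ?_))) _
  exact Tendsto.pow (tendsto_const_nhds.sub (tendsto_const_nhds.mul
    (tendsto_finsetSum _ fun k _ => h _))) _

section chain

variable {dl dr γ : ℕ} {ε : ℝ} {n : ℕ} {b : ℤ → ℝ}

theorem chainFP_mem (hε : 0 ≤ ε ∧ ε ≤ 1) (hb : ∀ i, 0 ≤ b i ∧ b i ≤ 1) (i : ℤ) :
    0 ≤ chainFP dl dr γ ε n b i ∧ chainFP dl dr γ ε n b i ≤ 1 :=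
  ⟨ge_of_tendsto' (tendsto_chainDE dl dr γ hε n hb i) fun ℓ => (chainDE_mem dl dr γ hε n hb ℓ i).1,
    le_of_tendsto' (tendsto_chainDE dl dr γ hε n hb i)
      fun ℓ => (chainDE_mem dl dr γ hε n hb ℓ i).2⟩

theorem chainFP_eq (hε : 0 ≤ ε ∧ ε ≤ 1) (hb : ∀ i, 0 ≤ b i ∧ b i ≤ 1) {i : ℤ}
    (hi : 1 ≤ i ∧ i ≤ (n : ℤ)) :
    chainFP dl dr γ ε n b i = ε * coupledG dl dr γ (chainFP dl dr γ ε n b) i := by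
  have h1 := (tendsto_chainDE dl dr γ hε n hb i).comp (tendsto_add_atTop_nat 1)
  have h2 := (tendsto_coupledG dl dr γ (tendsto_chainDE dl dr γ hε n hb) i).const_mul ε
  refine tendsto_nhds_unique h1 (h2.congr fun ℓ => ?_)
  simp [chainDE, hi]

theorem chainFP_of_notMem (hε : 0 ≤ ε ∧ ε ≤ 1) (hb : ∀ i, 0 ≤ b i ∧ b i ≤ 1) {i : ℤ}
    (hi : ¬(1 ≤ i ∧ i ≤ (n : ℤ))) : chainFP dl dr γ ε n b i = b i := by
  refine tendsto_nhds_unique (tendsto_chainDE dl dr γ hε n hb i)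
    (tendsto_const_nhds.congr fun ℓ => ?_)
  cases ℓ <;> simp only [chainDE, if_neg hi]

/-- The iteration starts from the largest admissible profile and is monotone, so a subsolution stays
below every iterate. -/
theorem le_chainFP (hε : 0 ≤ ε ∧ ε ≤ 1) (hb : ∀ i, 0 ≤ b i ∧ b i ≤ 1) {x : ℤ → ℝ}
    (hx : ∀ i, 0 ≤ x i ∧ x i ≤ 1) (hxb : ∀ i, ¬(1 ≤ i ∧ i ≤ (n : ℤ)) → x i ≤ b i)
    (hxg : ∀ i, 1 ≤ i ∧ i ≤ (n : ℤ) → x i ≤ ε * coupledG dl dr γ x i) (i : ℤ) :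
    x i ≤ chainFP dl dr γ ε n b i := by
  refine ge_of_tendsto' (tendsto_chainDE dl dr γ hε n hb i) fun ℓ => ?_
  induction ℓ generalizing i with
  | zero =>
    by_cases hi : 1 ≤ i ∧ i ≤ (n : ℤ)
    · simpa only [chainDE, if_pos hi] using (hx i).2
    · simpa only [chainDE, if_neg hi] using hxb i hi
  | succ ℓ ih =>
    by_cases hi : 1 ≤ i ∧ i ≤ (n : ℤ)
    · simp only [chainDE, if_pos hi]
      exact (hxg i hi).trans (mul_le_mul_of_nonneg_left (coupledG_mono dl dr γ hx
        (chainDE_mem dl dr γ hε n hb ℓ) ih i) hε.1)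
    · simpa only [chainDE, if_neg hi] using hxb i hi

/-- Every iterate is monotone: inside the chain compare the profile with its shift by one; at the
two ends the boundary values 0 and 1 are extreme. -/
theorem chainFP_monotone (hε : 0 ≤ ε ∧ ε ≤ 1) (hb : ∀ i, 0 ≤ b i ∧ b i ≤ 1)
    (hb0 : ∀ i ≤ 0, b i = 0) (hb1 : ∀ i > (n : ℤ), b i = 1) :
    Monotone (chainFP dl dr γ ε n b) := by
  refine monotone_int_of_le_succ fun i => le_of_tendsto_of_tendsto'
    (tendsto_chainDE dl dr γ hε n hb i) (tendsto_chainDE dl dr γ hε n hb (i + 1)) fun ℓ => ?_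
  have hmem := chainDE_mem dl dr γ hε n hb
  induction ℓ generalizing i with
  | zero =>
    by_cases h0 : i ≤ 0
    · have : chainDE dl dr γ ε n b 0 i = 0 := by
        simp only [chainDE, if_neg (by omega : ¬(1 ≤ i ∧ i ≤ (n : ℤ))), hb0 i h0]
      exact this ▸ (hmem 0 (i + 1)).1
    · have : chainDE dl dr γ ε n b 0 (i + 1) = 1 := by
        by_cases h1 : i + 1 ≤ (n : ℤ)
        · simp only [chainDE, if_pos (⟨by omega, h1⟩ : 1 ≤ i + 1 ∧ i + 1 ≤ (n : ℤ))]
        · simp only [chainDE, if_neg (fun h => h1 h.2 : ¬(1 ≤ i + 1 ∧ i + 1 ≤ (n : ℤ))),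
            hb1 (i + 1) (by omega)]
      exact this ▸ (hmem 0 i).2
  | succ ℓ ih =>
    by_cases h0 : i ≤ 0
    · have : chainDE dl dr γ ε n b (ℓ + 1) i = 0 := by
        simp only [chainDE, if_neg (by omega : ¬(1 ≤ i ∧ i ≤ (n : ℤ))), hb0 i h0]
      exact this ▸ (hmem (ℓ + 1) (i + 1)).1
    · by_cases h1 : i + 1 ≤ (n : ℤ)
      · simp only [chainDE, if_pos (by omega : 1 ≤ i ∧ i ≤ (n : ℤ)),
          if_pos (by omega : 1 ≤ i + 1 ∧ i + 1 ≤ (n : ℤ))]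
        rw [← coupledG_shift dl dr γ _ 1 i]
        exact mul_le_mul_of_nonneg_left (coupledG_mono dl dr γ (hmem ℓ)
          (fun j => hmem ℓ (j + 1)) ih i) hε.1
      · have : chainDE dl dr γ ε n b (ℓ + 1) (i + 1) = 1 := by
          simp only [chainDE, if_neg (fun h => h1 h.2 : ¬(1 ≤ i + 1 ∧ i + 1 ≤ (n : ℤ))),
            hb1 (i + 1) (by omega)]
        exact this ▸ (hmem (ℓ + 1) i).2

end chain

/-! ### Thresholds -/

theorem bpThresholdCoupled_le_chain (dl dr γ L : ℕ) :
    bpThresholdCoupled dl dr γ ≤ bpThresholdChain dl dr γ L :=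
  (bpThresholdChain_antitone dl dr γ).le_of_tendsto (tendsto_bpThresholdChain dl dr γ) L

theorem bpThresholdCoupled_le_one (dl dr γ : ℕ) : bpThresholdCoupled dl dr γ ≤ 1 :=
  (bpThresholdCoupled_le_chain dl dr γ 0).trans (Real.sSup_le (fun _ h => h.2.1) zero_le_one)

theorem bpThresholdRegular_nonneg (dl dr : ℕ) : 0 ≤ bpThresholdRegular dl dr :=
  Real.sSup_nonneg fun _ h => h.1

/-- Below the coupled threshold there is no compactly supported subsolution. -/
theorem eq_zero_of_le_coupledG {dl dr γ : ℕ} {ε : ℝ}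
    (hε : ε < bpThresholdCoupled dl dr γ) {x : ℤ → ℝ} {L : ℕ}
    (hx : ∀ i, 0 ≤ x i ∧ x i ≤ 1) (hx0 : ∀ i, ¬(1 ≤ i ∧ i ≤ (L : ℤ)) → x i = 0)
    (hxg : ∀ i, 1 ≤ i ∧ i ≤ (L : ℤ) → x i ≤ ε * coupledG dl dr γ x i) (i : ℤ) : x i = 0 := by
  have hL := hε.trans_le (bpThresholdCoupled_le_chain dl dr γ L)
  rw [bpThresholdChain] at hL
  have hne : {ε : ℝ | 0 ≤ ε ∧ ε ≤ 1 ∧ ∀ i : ℤ, bpFP dl dr γ ε L i = 0}.Nonempty :=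
    ⟨0, le_refl _, zero_le_one, bpFP_zero dl dr γ L⟩
  -- A subsolution at ε is one at the larger ε', where the fixed point on the chain vanishes.
  obtain ⟨ε', ⟨h0', h1', hz⟩, hlt⟩ := exists_lt_of_lt_csSup hne hL
  refine le_antisymm ?_ (hx i).1
  rw [← hz i]
  refine le_chainFP ⟨h0', h1'⟩ (fun _ => ⟨le_refl _, zero_le_one⟩) hx (fun i hi => (hx0 i hi).le)
    (fun i hi => (hxg i hi).trans ?_) i
  exact mul_le_mul_of_nonneg_right hlt.le (coupledG_mem dl dr γ hx i).1

/-! ### Window configurations -/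

/-- The properties of a window configuration fixed point that determine its transition width. -/
structure IsWindowFP (dl dr γ : ℕ) (ε : ℝ) (W : ℕ) (y : ℤ → ℝ) : Prop where
  mem : ∀ i, 0 ≤ y i ∧ y i ≤ 1
  mono : Monotone y
  eq_zero : ∀ i ≤ 0, y i = 0
  eq_one : ∀ i > (W : ℤ), y i = 1
  eq : ∀ i, 1 ≤ i → i ≤ (W : ℤ) → y i = ε * coupledG dl dr γ y i

theorem isWindowFP_fwFP (dl dr γ : ℕ) {ε : ℝ} (hε : 0 ≤ ε ∧ ε ≤ 1) (W : ℕ) :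
    IsWindowFP dl dr γ ε W (fwFP dl dr γ ε W) := by
  have hb : ∀ i : ℤ, 0 ≤ (if i ≤ 0 then (0 : ℝ) else 1) ∧ (if i ≤ 0 then (0 : ℝ) else 1) ≤ 1 := by
    intro i; split_ifs <;> norm_num
  refine ⟨chainFP_mem hε hb, chainFP_monotone hε hb (fun i hi => if_pos hi)
    (fun i hi => if_neg (by omega)), fun i hi => ?_, fun i hi => ?_,
    fun i h1 h2 => chainFP_eq hε hb ⟨h1, h2⟩⟩
  · exact (chainFP_of_notMem hε hb (by omega)).trans (if_pos hi)
  · exact (chainFP_of_notMem hε hb (by omega)).trans (if_neg (by omega))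

namespace IsWindowFP

variable {dl dr γ : ℕ} {ε : ℝ} {W : ℕ} {y : ℤ → ℝ}

theorem one_le (hy : IsWindowFP dl dr γ ε W y) {i : ℤ} (hi : 0 < y i) : 1 ≤ i := by
  by_contra h
  exact hi.ne' (hy.eq_zero i (by omega))

theorem le_window (hy : IsWindowFP dl dr γ ε W y) {i : ℤ} (hi : y i < 1) : i ≤ W := by
  by_contra h
  exact hi.ne (hy.eq_one i (by omega))

/-- Below the coupled threshold, a window fixed point cannot be too flat: otherwise reflecting it
would give a compactly supported subsolution. -/
theorem mul_pow_le (hy : IsWindowFP dl dr γ ε W y) (hγ : 0 < γ) (hε0 : 0 ≤ ε)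
    {i : ℤ} (hi : 0 < y i) (hiW : i ≤ W) :
    bpThresholdCoupled dl dr γ * y (i - γ) ^ (dl - 1) ≤ ε * y (i + γ) ^ (dl - 1) := by
  by_contra! hlt
  have hp : 0 < y (i + γ) := hi.trans_le (hy.mono (by omega))
  have hm : 0 < y (i - γ) ^ (dl - 1) := by
    have h2 : 0 ≤ ε * y (i + γ) ^ (dl - 1) := by positivity
    refine (pow_nonneg (hy.mem _).1 _).lt_of_ne' fun h => ?_
    rw [h, mul_zero] at hlt
    linarith
  -- The rate ε' is still below the coupled threshold, yet large enough to pay for the factor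
  -- θ^(dl-1) lost by the reflection.
  obtain ⟨ε', h1, h2⟩ := exists_between ((div_lt_iff₀ hm).2 hlt)
  rw [div_lt_iff₀ hm] at h1
  set θ := y (i - γ) / y (i + γ) with hθ
  have hle : y (i - γ) ≤ y (i + γ) := hy.mono (by omega)
  have hθ0 : 0 ≤ θ := div_nonneg (hy.mem _).1 hp.le
  have hθ1 : θ ≤ 1 := div_le_one_of_le₀ hle hp.le
  have hθm : θ * y (i + γ) = y (i - γ) := div_mul_cancel₀ _ hp.ne'
  have hεθ : ε ≤ ε' * θ ^ (dl - 1) := by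
    rw [hθ, div_pow, mul_div_assoc', le_div_iff₀ (by positivity)]
    exact h1.le
  have hε'0 : 0 ≤ ε' := by
    by_contra! h
    nlinarith [mul_nonneg hε0 (pow_nonneg hp.le (dl - 1))]
  have hi1 := hy.one_le hi
  -- Reflection at i. In the window of a section j ≤ i, a value y k with i < k < i + γ is replaced
  -- by y (2i - k) ≥ y (i - γ) = θ y (i + γ) ≥ θ y k.
  let x : ℤ → ℝ := fun j => if j ≤ i then y j else y (2 * i - j)
  have hxsymm : (fun j => x (2 * i - j)) = x := by
    ext j
    simp only [x]
    split_ifs with h1 h2 h2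
    · congr 1; omega
    · rfl
    · congr 1; omega
    · omega
  have hx : ∀ j, 0 ≤ x j ∧ x j ≤ 1 := by
    intro j; simp only [x]; split_ifs <;> exact hy.mem _
  have hxg : ∀ j, 1 ≤ j → j ≤ i → x j ≤ ε' * coupledG dl dr γ x j := by
    intro j h1 hji
    have hxj : x j = ε * coupledG dl dr γ y j := by
      simp only [x, if_pos hji]
      exact hy.eq j h1 (hji.trans hiW)
    have hs := mul_coupledG_le dl dr hγ (i := j) hθ0 hθ1 (fun j => (hx j).2) hy.mem
      (fun k hk1 hk2 => ?_)
    · rw [hxj]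
      calc ε * coupledG dl dr γ y j ≤ (ε' * θ ^ (dl - 1)) * coupledG dl dr γ y j :=
            mul_le_mul_of_nonneg_right hεθ (coupledG_mem dl dr γ hy.mem j).1
        _ ≤ ε' * coupledG dl dr γ x j := by
            rw [mul_assoc]; exact mul_le_mul_of_nonneg_left hs hε'0
    · simp only [x]
      split_ifs with hki
      · exact mul_le_of_le_one_left (hy.mem k).1 hθ1
      · calc θ * y k ≤ θ * y (i + γ) := mul_le_mul_of_nonneg_left (hy.mono (by omega)) hθ0
          _ = y (i - γ) := hθm
          _ ≤ y (2 * i - k) := hy.mono (by omega)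
  have hz := eq_zero_of_le_coupledG (L := (2 * i - 1).toNat) h2 hx (fun j hj => ?_)
    (fun j hj => ?_) i
  · simp only [x, le_refl, if_true] at hz
    exact hi.ne' hz
  · simp only [x]
    split_ifs <;> exact hy.eq_zero _ (by omega)
  · by_cases hji : j ≤ i
    · exact hxg j hj.1 hji
    · have h3 := hxg (2 * i - j) (by omega) (by omega)
      rw [← coupledG_reflect dl dr hγ, hxsymm] at h3
      rwa [congrFun hxsymm j] at h3

end IsWindowFP

/-! ### The uncoupled recursion -/

theorem pow_checkFn_mono (m n : ℕ) {x y : ℝ} (hx : 0 ≤ x) (hy : y ≤ 1) (hxy : x ≤ y) :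
    checkFn n x ^ m ≤ checkFn n y ^ m :=
  pow_le_pow_left₀ (checkFn_nonneg n hx (hxy.trans hy)) (checkFn_mono n hy hxy) m

theorem regularDE_mem (dl dr : ℕ) {ε : ℝ} (hε : 0 ≤ ε ∧ ε ≤ 1) (ℓ : ℕ) :
    0 ≤ regularDE dl dr ε ℓ ∧ regularDE dl dr ε ℓ ≤ 1 := by
  induction ℓ with
  | zero => simp [regularDE]
  | succ ℓ ih =>
    have h0 := checkFn_nonneg (dr - 1) ih.1 ih.2
    exact ⟨mul_nonneg hε.1 (pow_nonneg h0 _),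
      mul_le_one₀ hε.2 (pow_nonneg h0 _) (pow_le_one₀ h0 (checkFn_le_one _ ih.2))⟩

theorem regularDE_antitone (dl dr : ℕ) {ε : ℝ} (hε : 0 ≤ ε ∧ ε ≤ 1) :
    Antitone (regularDE dl dr ε) := by
  refine antitone_nat_of_succ_le fun ℓ => ?_
  induction ℓ with
  | zero => exact (regularDE_mem dl dr hε 1).2
  | succ ℓ ih =>
    exact mul_le_mul_of_nonneg_left (pow_checkFn_mono _ _ (regularDE_mem dl dr hε _).1
      (regularDE_mem dl dr hε _).2 ih) hε.1

/-- Above the uncoupled threshold, density evolution stops at the largest fixed point, which is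
positive. -/
theorem exists_regular_fixedPoint (dl dr : ℕ) {ε : ℝ} (h1 : ε ≤ 1)
    (hε : bpThresholdRegular dl dr < ε) :
    ∃ x, 0 < x ∧ x ≤ 1 ∧ ε * checkFn (dr - 1) x ^ (dl - 1) = x ∧
      ∀ z, x < z → z ≤ 1 → ε * checkFn (dr - 1) z ^ (dl - 1) < z := by
  have h0 : 0 ≤ ε := (bpThresholdRegular_nonneg dl dr).trans hε.le
  have hmem := regularDE_mem dl dr ⟨h0, h1⟩
  have hlim : Tendsto (regularDE dl dr ε) atTop (𝓝 (⨅ ℓ, regularDE dl dr ε ℓ)) :=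
    tendsto_atTop_ciInf (regularDE_antitone dl dr ⟨h0, h1⟩) ⟨0, by rintro _ ⟨ℓ, rfl⟩; exact (hmem ℓ).1⟩
  set x := ⨅ ℓ, regularDE dl dr ε ℓ
  have hx0 : 0 ≤ x := ge_of_tendsto' hlim fun ℓ => (hmem ℓ).1
  refine ⟨x, hx0.lt_of_ne fun h => ?_, le_of_tendsto' hlim fun ℓ => (hmem ℓ).2, ?_, ?_⟩
  · rw [← h] at hlim
    exact hε.not_ge (le_csSup ⟨1, fun _ h => h.2.1⟩ ⟨h0, h1, hlim⟩)
  · have h2 := ((((continuous_checkFn (dr - 1)).tendsto x).comp hlim).pow (dl - 1)).const_mul ε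
    exact tendsto_nhds_unique h2 (hlim.comp (tendsto_add_atTop_nat 1))
  · intro z hxz hz1
    -- A level z that is not decreased would be a lower bound for all iterates, hence for their
    -- limit x < z.
    by_contra! hz
    refine hxz.not_ge (ge_of_tendsto' hlim fun ℓ => ?_)
    induction ℓ with
    | zero => exact hz1
    | succ ℓ ih =>
      exact hz.trans (mul_le_mul_of_nonneg_left
        (pow_checkFn_mono _ _ (hx0.trans hxz.le) (hmem ℓ).2 ih) h0)

theorem log_mul_pow {ε c : ℝ} (hε : 0 < ε) (hc : 0 < c) (m : ℕ) :
    Real.log (ε * c ^ m) = Real.log ε + m * Real.log c := by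
  rw [Real.log_mul hε.ne' (pow_pos hc m).ne', Real.log_pow]

/-- Above the uncoupled threshold there is a level `α` which density evolution increases, and
above which it is a contraction in logarithmic coordinates. -/
theorem exists_contraction_level {dl dr : ℕ} (hdl : 2 ≤ dl) (hdr : 2 ≤ dr) {ε₀ : ℝ} (h1 : ε₀ ≤ 1)
    (hε : bpThresholdRegular dl dr < ε₀) :
    ∃ α q : ℝ, 0 < α ∧ α ≤ 1 ∧ 0 < q ∧ q < 1 ∧ α < ε₀ * checkFn (dr - 1) α ^ (dl - 1) ∧
      ∀ a b, α ≤ a → a ≤ b → b ≤ 1 →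
        ((dl - 1 : ℕ) : ℝ) * (Real.log (checkFn (dr - 1) b) - Real.log (checkFn (dr - 1) a)) ≤
          q * (Real.log b - Real.log a) := by
  -- Two rates are used: x is the largest fixed point at ε, so ε lowers every level above x, while
  -- the larger ε₀ still raises the levels just above x. The level α is taken among the latter.
  obtain ⟨ε, hε1, hε2⟩ := exists_between hε
  have hn : 1 ≤ dr - 1 := by omega
  have hε0 : 0 < ε := (bpThresholdRegular_nonneg dl dr).trans_lt hε1
  obtain ⟨x, hx0, hx1, hfix, hmax⟩ := exists_regular_fixedPoint dl dr (hε2.le.trans h1) hε1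
  have hxpos : 0 < checkFn (dr - 1) x ^ (dl - 1) := pow_pos (checkFn_pos hn hx0 hx1) _
  have hxlt : x < 1 := by
    have : checkFn (dr - 1) x ^ (dl - 1) ≤ 1 :=
      pow_le_one₀ (checkFn_nonneg _ hx0.le hx1) (checkFn_le_one _ hx1)
    calc x = ε * checkFn (dr - 1) x ^ (dl - 1) := hfix.symm
      _ ≤ ε := mul_le_of_le_one_right hε0.le this
      _ < 1 := hε2.trans_le h1
  have hcont : Continuous fun z => ε₀ * checkFn (dr - 1) z ^ (dl - 1) - z := by
    have := continuous_checkFn (dr - 1)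
    fun_prop
  have hev : ∀ᶠ z in 𝓝[>] x, 0 < ε₀ * checkFn (dr - 1) z ^ (dl - 1) - z := by
    refine (hcont.tendsto x).eventually_const_lt ?_ |>.filter_mono nhdsWithin_le_nhds
    have := mul_lt_mul_of_pos_right hε2 hxpos
    linarith
  obtain ⟨α, hα, hαx, hα1⟩ := (hev.and (Ioo_mem_nhdsGT hxlt)).exists
  have hα0 : 0 < α := hx0.trans hαx
  set L : ℝ → ℝ := fun z => Real.log (checkFn (dr - 1) z) with hL
  set m : ℝ := ((dl - 1 : ℕ) : ℝ) with hm
  have hm0 : 0 < m := by rw [hm]; exact_mod_cast (by omega : 0 < dl - 1)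
  have hden : 0 < Real.log α - Real.log x := sub_pos.2 (Real.log_lt_log hx0 hαx)
  -- At rate ε the level x is fixed and α is lowered, so the chord over [x, α] has slope below 1;
  -- chords to its right are no steeper.
  have hslope : m * ((L α - L x) / (Real.log α - Real.log x)) < 1 := by
    rw [mul_div_assoc', div_lt_one hden]
    have e1 : Real.log ε + m * L x = Real.log x := by
      rw [← log_mul_pow hε0 (checkFn_pos hn hx0 hx1), hfix]
    have e2 : Real.log ε + m * L α < Real.log α := by
      rw [← log_mul_pow hε0 (checkFn_pos hn hα0 hα1.le)]
      exact Real.log_lt_log (mul_pos hε0 (pow_pos (checkFn_pos hn hα0 hα1.le) _))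
        (hmax α hαx hα1.le)
    linarith
  obtain ⟨q, hq1, hq2⟩ := exists_between (max_lt hslope zero_lt_one)
  have hq0 := (le_max_right _ _).trans_lt hq1
  have hqs := ((le_max_left _ _).trans_lt hq1).le
  refine ⟨α, q, hα0, hα1.le, hq0, hq2, by linarith, fun a b ha hab hb => ?_⟩
  rcases hab.eq_or_lt with rfl | hab
  · simp
  have ha0 := hα0.trans_le ha
  have hd : 0 < Real.log b - Real.log a := sub_pos.2 (Real.log_lt_log ha0 hab)
  rw [← div_le_iff₀ hd, ← mul_div_assoc']
  refine (mul_le_mul_of_nonneg_left ?_ hm0.le).trans hqs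
  rcases ha.eq_or_lt with rfl | ha
  · exact log_checkFn_slope hn hx0 hαx hab hb
  · exact (log_checkFn_slope hn hα0 ha hab hb).trans
      (log_checkFn_slope hn hx0 hαx ha (hab.le.trans hb))

/-- Between a level `β` that density evolution decreases and a level `α` that it increases, there
is a fixed point around which it expands in logarithmic coordinates. -/
theorem exists_expanding_fixedPoint {m n : ℕ} (hn : 1 ≤ n) {ε₀ ε α β : ℝ}
    (hε₀ : 0 < ε₀) (hε : ε₀ ≤ ε) (hβ0 : 0 < β) (hβα : β < α) (hα1 : α ≤ 1)
    (hβ : ε * checkFn n β ^ m < β) (hα : α < ε₀ * checkFn n α ^ m) :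
    ∃ p, β < p ∧ p < α ∧ ε * checkFn n p ^ m = p ∧
      (∀ c, 0 < c → c ≤ p → ((1 + Real.log (ε₀ * checkFn n α ^ m / α) / Real.log (1 / β)) *
        (Real.log p - Real.log c) ≤ m * (Real.log (checkFn n p) - Real.log (checkFn n c)))) ∧
      (∀ c, p ≤ c → c ≤ α → ((1 + Real.log (ε₀ * checkFn n α ^ m / α) / Real.log (1 / β)) *
        (Real.log c - Real.log p) ≤ m * (Real.log (checkFn n c) - Real.log (checkFn n p)))) := by
  have hε0 := hε₀.trans_le hε
  have hα0 := hβ0.trans hβα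
  have hcont : Continuous fun z => ε * checkFn n z ^ m - z := by
    have := continuous_checkFn n
    fun_prop
  have hαpos : 0 < checkFn n α ^ m := pow_pos (checkFn_pos hn hα0 hα1) _
  have hαε : α < ε * checkFn n α ^ m := hα.trans_le (mul_le_mul_of_nonneg_right hε hαpos.le)
  obtain ⟨p, ⟨hp1, hp2⟩, hp⟩ := intermediate_value_Ioo hβα.le hcont.continuousOn
    (show (0 : ℝ) ∈ Set.Ioo _ _ from ⟨by linarith, by linarith⟩)
  have hfix : ε * checkFn n p ^ m = p := by simpa [sub_eq_zero] using hp
  have hp0 := hβ0.trans hp1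
  have hd : 0 < Real.log α - Real.log p := sub_pos.2 (Real.log_lt_log hp0 hp2)
  -- A lower bound for the chord slope over [p, α] that does not involve p or ε: the gain at α is at
  -- least its value for ε₀, and log(α/p) ≤ log(1/β).
  set κ := 1 + Real.log (ε₀ * checkFn n α ^ m / α) / Real.log (1 / β) with hκ
  have hμ : 0 < Real.log (ε₀ * checkFn n α ^ m / α) := Real.log_pos ((one_lt_div hα0).2 hα)
  have hslope : κ * (Real.log α - Real.log p) ≤
      m * (Real.log (checkFn n α) - Real.log (checkFn n p)) := by
    have e1 : Real.log ε + m * Real.log (checkFn n p) = Real.log p := by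
      rw [← log_mul_pow hε0 (checkFn_pos hn hp0 (hp2.le.trans hα1)), hfix]
    have e2 : Real.log (ε₀ * checkFn n α ^ m / α) =
        Real.log ε₀ + m * Real.log (checkFn n α) - Real.log α := by
      rw [Real.log_div (mul_pos hε₀ hαpos).ne' hα0.ne',
        log_mul_pow hε₀ (checkFn_pos hn hα0 hα1)]
    have e3 := Real.log_le_log hε₀ hε
    have e4 : Real.log α - Real.log p ≤ Real.log (1 / β) := by
      rw [one_div, Real.log_inv]
      linarith [Real.log_nonpos hα0.le hα1, Real.log_lt_log hβ0 hp1]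
    have e5 : Real.log (ε₀ * checkFn n α ^ m / α) / Real.log (1 / β) *
        (Real.log α - Real.log p) ≤ Real.log (ε₀ * checkFn n α ^ m / α) := by
      rw [div_mul_eq_mul_div, div_le_iff₀ (hd.trans_le e4)]
      exact mul_le_mul_of_nonneg_left e4 hμ.le
    rw [hκ, add_mul, one_mul]
    linarith
  have hm0 : (0 : ℝ) ≤ m := Nat.cast_nonneg m
  rw [← le_div_iff₀ hd, mul_div_assoc] at hslope
  refine ⟨p, hp1, hp2, hfix, fun c hc0 hcp => ?_, fun c hpc hcα => ?_⟩
  · rcases hcp.eq_or_lt with rfl | hcp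
    · simp
    · rw [← le_div_iff₀ (sub_pos.2 (Real.log_lt_log hc0 hcp)), mul_div_assoc]
      exact hslope.trans (mul_le_mul_of_nonneg_left (log_checkFn_slope hn hc0 hcp hp2 hα1) hm0)
  · rcases hpc.eq_or_lt with rfl | hpc
    · simp
    · rw [← le_div_iff₀ (sub_pos.2 (Real.log_lt_log hp0 hpc)), mul_div_assoc]
      refine hslope.trans (mul_le_mul_of_nonneg_left ?_ hm0)
      rcases hcα.eq_or_lt with rfl | hcα
      · exact le_refl _
      -- the chord over `[p, α]` is no steeper than the one over `[p, c]`
      have h := log_checkFn_slope hn hp0 hpc hcα hα1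
      have d1 : 0 < Real.log c - Real.log p := sub_pos.2 (Real.log_lt_log hp0 hpc)
      have d2 : 0 < Real.log α - Real.log c :=
        sub_pos.2 (Real.log_lt_log (hp0.trans hpc) hcα)
      rw [div_le_div_iff₀ d2 d1] at h
      rw [div_le_div_iff₀ hd d1]
      nlinarith

/-! ### Double averages of monotone sequences -/

/-- A nonnegative monotone sequence that dominates a multiple `κ > 1` of its double average can
only do so on a bounded stretch. -/
theorem length_le_of_mul_mean_le {γ : ℕ} (hγ : 0 < γ) {κ : ℝ} (hκ : 1 < κ) {u : ℤ → ℝ} {a : ℤ}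
    {N : ℕ}
    (hmono : ∀ i j, a ≤ i → i ≤ j → j ≤ a + N + 2 * γ → u i ≤ u j)
    (hpos : ∀ i, a ≤ i → i ≤ a + N + 2 * γ → 0 < u i)
    (h : ∀ i, a + γ ≤ i → i < a + γ + N →
      κ * mean γ (fun j => mean γ fun k => u (i + (j : ℤ) - (k : ℤ))) ≤ u i) :
    (N : ℝ) ≤ γ + κ * γ / (κ - 1) := by
  set v := u (a + 2 * γ) with hv
  have hv0 : 0 < v := hpos _ (by omega) (by omega)
  set S := ∑ t ∈ Finset.range N, u (a + γ + t) with hS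
  -- sums over stretches shifted by `d` and `-d`
  have hshift : ∀ d : ℕ, d ≤ γ → 2 * S - γ * v ≤
      ∑ t ∈ Finset.range N, u (a + γ + t + d) + ∑ t ∈ Finset.range N, u (a + γ + t - d) := by
    intro d hd
    set e : ℕ → ℝ := fun t => u (a + γ + t) - u (a + γ + t - d) with he
    have h1 : ∑ t ∈ Finset.range N, e t ≤ ∑ t ∈ Finset.range (d + N), e t :=
      Finset.sum_le_sum_of_subset_of_nonneg (Finset.range_mono (by omega)) fun t ht _ =>
        sub_nonneg.2 (hmono _ _ (by omega) (by omega)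
          (by have := Finset.mem_range.1 ht; omega))
    have h2 : ∑ t ∈ Finset.range (d + N), e t = ∑ t ∈ Finset.range d, e t +
        ∑ t ∈ Finset.range N, e (d + t) := Finset.sum_range_add _ _ _
    have h3 : ∑ t ∈ Finset.range d, e t ≤ γ * v := by
      calc ∑ t ∈ Finset.range d, e t ≤ ∑ t ∈ Finset.range d, v := by
            refine Finset.sum_le_sum fun t ht => ?_
            have ht' := Finset.mem_range.1 ht
            have p1 := hpos (a + γ + t - d) (by omega) (by omega)
            have p2 := hmono (a + γ + t) (a + 2 * γ) (by omega) (by omega) (by omega)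
            simp only [he]; linarith
        _ = d * v := by simp
        _ ≤ γ * v := by gcongr
    have h4 : ∑ t ∈ Finset.range N, e (d + t) =
        ∑ t ∈ Finset.range N, u (a + γ + t + d) - S := by
      rw [hS, ← Finset.sum_sub_distrib]
      refine Finset.sum_congr rfl fun t _ => ?_
      simp only [he]
      congr 2 <;> push_cast <;> ring
    have h5 : ∑ t ∈ Finset.range N, e t = S - ∑ t ∈ Finset.range N, u (a + γ + t - d) := by
      rw [hS, ← Finset.sum_sub_distrib]
    linarith
  -- Pairing (j, k) with (k, j) in the double average makes opposite shifts occur together, so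
  -- `hshift` applies to each pair.
  have hsum : 2 * S ≥ κ * (2 * S - γ * v) := by
    have hterm : ∀ j < γ, ∀ k < γ, 2 * S - γ * v ≤ ∑ t ∈ Finset.range N,
        (u (a + γ + t + (j : ℤ) - (k : ℤ)) + u (a + γ + t + (k : ℤ) - (j : ℤ))) := by
      intro j hj k hk
      rw [Finset.sum_add_distrib]
      rcases le_total k j with hkj | hkj
      · have := hshift (j - k) (by omega)
        have e1 : ∀ t : ℕ, a + γ + t + ((j - k : ℕ) : ℤ) = a + γ + t + (j : ℤ) - (k : ℤ) := by
          omega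
        have e2 : ∀ t : ℕ, a + γ + t - ((j - k : ℕ) : ℤ) = a + γ + t + (k : ℤ) - (j : ℤ) := by
          omega
        simp only [e1, e2] at this
        exact this
      · have := hshift (k - j) (by omega)
        have e1 : ∀ t : ℕ, a + γ + t + ((k - j : ℕ) : ℤ) = a + γ + t + (k : ℤ) - (j : ℤ) := by
          omega
        have e2 : ∀ t : ℕ, a + γ + t - ((k - j : ℕ) : ℤ) = a + γ + t + (j : ℤ) - (k : ℤ) := by
          omega
        simp only [e1, e2] at this
        rwa [add_comm]
    have hcomm : ∀ i : ℤ, mean γ (fun j => mean γ fun k => u (i + (k : ℤ) - (j : ℤ))) =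
        mean γ (fun j => mean γ fun k => u (i + (j : ℤ) - (k : ℤ))) := by
      intro i
      simp only [mean, ← Finset.mul_sum]
      rw [Finset.sum_comm]
    have h1 : ∀ t ∈ Finset.range N, κ * (mean γ fun j => mean γ fun k =>
        (u (a + γ + t + (j : ℤ) - (k : ℤ)) + u (a + γ + t + (k : ℤ) - (j : ℤ)))) ≤
          2 * u (a + γ + t) := by
      intro t ht
      simp only [mean_add, hcomm]
      have := h (a + γ + t) (by omega) (by have := Finset.mem_range.1 ht; omega)
      linarith
    have h2 := Finset.sum_le_sum h1
    rw [← Finset.mul_sum, ← Finset.mul_sum] at h2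
    refine le_trans (mul_le_mul_of_nonneg_left ?_ (by linarith)) h2
    have h3 : ∑ t ∈ Finset.range N, (mean γ fun j => mean γ fun k =>
        (u (a + γ + t + (j : ℤ) - (k : ℤ)) + u (a + γ + t + (k : ℤ) - (j : ℤ)))) =
        mean γ fun j => mean γ fun k => ∑ t ∈ Finset.range N,
          (u (a + γ + t + (j : ℤ) - (k : ℤ)) + u (a + γ + t + (k : ℤ) - (j : ℤ))) := by
      simp only [mean, ← Finset.mul_sum]
      congr 1
      rw [Finset.sum_comm]
      congr 1
      refine Finset.sum_congr rfl fun j _ => ?_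
      rw [Finset.sum_comm]
    rw [h3]
    exact le_mean hγ fun j hj => le_mean hγ fun k hk => hterm j hj k hk
  -- All but the first γ terms of S are at least v by monotonicity.
  have hSlow : ((N : ℝ) - γ) * v ≤ S := by
    rcases le_total N γ with hN | hN
    · have : (0 : ℝ) ≤ S := Finset.sum_nonneg fun t ht =>
        (hpos _ (by omega) (by have := Finset.mem_range.1 ht; omega)).le
      have hN' : (N : ℝ) ≤ γ := by exact_mod_cast hN
      nlinarith
    · obtain ⟨M, rfl⟩ := Nat.exists_eq_add_of_le hN
      rw [hS, Finset.sum_range_add]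
      have h1 : 0 ≤ ∑ t ∈ Finset.range γ, u (a + γ + t) := Finset.sum_nonneg fun t ht =>
        (hpos _ (by omega) (by have := Finset.mem_range.1 ht; omega)).le
      have h2 : ∑ _t ∈ Finset.range M, v ≤ ∑ t ∈ Finset.range M, u (a + γ + ((γ + t : ℕ) : ℤ)) :=
        Finset.sum_le_sum fun t ht => hmono _ _ (by omega) (by omega)
          (by have := Finset.mem_range.1 ht; omega)
      simp only [Finset.sum_const, Finset.card_range, nsmul_eq_mul] at h2
      push_cast
      push_cast at h2
      linarith
  have hκ' : 0 < κ - 1 := by linarith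
  have hγ' : (0 : ℝ) < γ := by positivity
  rw [← sub_le_iff_le_add', le_div_iff₀ hκ']
  have h6 : (((N : ℝ) - γ) * (κ - 1)) * v ≤ (κ * γ) * v := by
    nlinarith [mul_le_mul_of_nonneg_left hSlow hκ'.le, mul_pos (mul_pos (by linarith : 0 < κ) hγ') hv0]
  exact le_of_mul_le_mul_right h6 hv0

/-! ### The level `deltaZero` -/

theorem deltaZero_pos {dr : ℕ} (dl : ℕ) (hdr : 2 ≤ dr) : 0 < deltaZero dl dr := by
  have h : (0 : ℝ) < (dr : ℝ) - 1 := by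
    have : (2 : ℝ) ≤ dr := by exact_mod_cast hdr
    linarith
  exact inv_pos.2 (Real.rpow_pos_of_pos h _)

theorem deltaZero_le_one {dl dr : ℕ} (hdl : 3 ≤ dl) (hdr : 2 ≤ dr) : deltaZero dl dr ≤ 1 := by
  have h2 : (2 : ℝ) ≤ dr := by exact_mod_cast hdr
  have h3 : (3 : ℝ) ≤ dl := by exact_mod_cast hdl
  exact inv_le_one_of_one_le₀ (Real.one_le_rpow (by linarith)
    (div_nonneg (by linarith) (by linarith)))

/-- The reason for the form of δ₀: it is the positive fixed point of the power map that majorizes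
density evolution. -/
theorem mul_deltaZero_pow {dl dr : ℕ} (hdl : 3 ≤ dl) (hdr : 2 ≤ dr) :
    (((dr - 1 : ℕ) : ℝ) * deltaZero dl dr) ^ (dl - 1) = deltaZero dl dr := by
  have h2 : (2 : ℝ) ≤ dr := by exact_mod_cast hdr
  have h3 : (3 : ℝ) ≤ dl := by exact_mod_cast hdl
  have hx : (0 : ℝ) < (dr : ℝ) - 1 := by linarith
  have hl : (dl : ℝ) - 2 ≠ 0 := by linarith
  rw [deltaZero, Nat.cast_sub (by omega : 1 ≤ dr), Nat.cast_one, ← Real.rpow_neg hx.le]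
  nth_rewrite 1 [← Real.rpow_one ((dr : ℝ) - 1)]
  rw [← Real.rpow_add hx, ← Real.rpow_natCast, ← Real.rpow_mul hx.le,
    Nat.cast_sub (by omega : 1 ≤ dl), Nat.cast_one]
  congr 1
  field_simp
  ring

/-! ### Counting -/

/-- Finiteness is part of the conclusion because `Set.ncard` of an infinite set is 0, and comparing
a set with a union later needs a finite union. -/
theorem ncard_le_of_sub_le {S : Set ℤ} {b : ℝ} (hb : 0 ≤ b)
    (h : ∀ i ∈ S, ∀ j ∈ S, i ≤ j → (j : ℝ) - i ≤ b) : S.Finite ∧ (S.ncard : ℝ) ≤ b + 1 := by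
  rcases S.eq_empty_or_nonempty with rfl | ⟨s, hs⟩
  · simp; linarith
  have hfin : S.Finite := by
    refine (Set.finite_Icc (s - ⌊b⌋) (s + ⌊b⌋)).subset fun i hi => ?_
    have hb' : 0 ≤ ⌊b⌋ := Int.floor_nonneg.2 hb
    rcases le_total s i with h1 | h1
    · have h2 : i - s ≤ ⌊b⌋ := Int.le_floor.2 (by push_cast; exact h s hs i hi h1)
      exact ⟨by omega, by omega⟩
    · have h2 : s - i ≤ ⌊b⌋ := Int.le_floor.2 (by push_cast; exact h i hi s hs h1)
      exact ⟨by omega, by omega⟩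
  refine ⟨hfin, ?_⟩
  obtain ⟨i, hi, hmin⟩ := Set.exists_min_image S id hfin ⟨s, hs⟩
  obtain ⟨j, hj, hmax⟩ := Set.exists_max_image S id hfin ⟨s, hs⟩
  have hij : i ≤ j := hmin j hj
  have hcard : S.ncard ≤ (Set.Icc i j).ncard :=
    Set.ncard_le_ncard (fun k hk => ⟨hmin k hk, hmax k hk⟩) (Set.finite_Icc i j)
  rw [← Finset.coe_Icc, Set.ncard_coe_finset, Int.card_Icc] at hcard
  have h1 : (S.ncard : ℤ) ≤ j + 1 - i := by omega
  have h2 : (S.ncard : ℝ) ≤ j + 1 - i := by exact_mod_cast h1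
  linarith [h i hi j hj hij]

namespace IsWindowFP

variable {dl dr γ : ℕ} {ε : ℝ} {W : ℕ} {y : ℤ → ℝ}

/-! ### The doubly exponential tail -/

/-- The window of section i - (γ - 1) ends at i, where monotone `y` is largest, and 1 - (1 - x)^n ≤
n x. -/
theorem sub_le_pow (hy : IsWindowFP dl dr γ ε W y) (hγ : 0 < γ) (hε : 0 ≤ ε ∧ ε ≤ 1) {i : ℤ}
    (hi : i ≤ W) : y (i - ((γ : ℤ) - 1)) ≤ (((dr - 1 : ℕ) : ℝ) * y i) ^ (dl - 1) := by
  have hpos : 0 ≤ (((dr - 1 : ℕ) : ℝ) * y i) ^ (dl - 1) :=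
    pow_nonneg (mul_nonneg (Nat.cast_nonneg _) (hy.mem i).1) _
  by_cases h : i - ((γ : ℤ) - 1) ≤ 0
  · rwa [hy.eq_zero _ h]
  rw [hy.eq _ (by omega) (by omega)]
  refine (mul_le_of_le_one_left (coupledG_mem dl dr γ hy.mem _).1 hε.2).trans ?_
  rw [coupledG_eq _ _ hγ]
  have hmem : ∀ c : ℕ → ℤ, 0 ≤ (mean γ fun k => y (c k)) ∧ (mean γ fun k => y (c k)) ≤ 1 :=
    fun c => ⟨le_mean hγ fun k _ => (hy.mem _).1, mean_le hγ fun k _ => (hy.mem _).2⟩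
  refine pow_le_pow_left₀ (le_mean hγ fun j _ => checkFn_nonneg _ (hmem _).1 (hmem _).2)
    (mean_le hγ fun j hj => ?_) _
  refine (checkFn_mono _ (hy.mem i).2 (mean_le hγ fun k hk => hy.mono ?_)).trans
    (checkFn_le_mul _ (hy.mem i).2)
  omega

theorem sub_mul_le (hy : IsWindowFP dl dr γ ε W y) (hγ : 0 < γ) (hε : 0 ≤ ε ∧ ε ≤ 1)
    (hdl : 3 ≤ dl) (hdr : 2 ≤ dr) {j : ℤ} (hj : y j ≤ deltaZero dl dr / 2) (t : ℕ) :
    y (j - t * ((γ : ℤ) - 1)) ≤ deltaZero dl dr * (1 / 2) ^ ((dl - 1) ^ t) := by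
  have hjW : j ≤ W := hy.le_window (by linarith [deltaZero_le_one hdl hdr])
  induction t with
  | zero => simpa [div_eq_mul_inv] using hj
  | succ t ih =>
    have h0 : 0 ≤ (t : ℤ) * ((γ : ℤ) - 1) := mul_nonneg (by omega) (by omega)
    have h1 := hy.sub_le_pow hγ hε (i := j - t * ((γ : ℤ) - 1)) (by omega)
    have e : j - ((t + 1 : ℕ) : ℤ) * ((γ : ℤ) - 1) = j - t * ((γ : ℤ) - 1) - ((γ : ℤ) - 1) := by
      push_cast; ring
    rw [e]
    refine h1.trans ((pow_le_pow_left₀ (mul_nonneg (Nat.cast_nonneg _) (hy.mem _).1)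
      (mul_le_mul_of_nonneg_left ih (Nat.cast_nonneg _)) _).trans_eq ?_)
    rw [← mul_assoc, mul_pow, mul_deltaZero_pow hdl hdr, ← pow_mul, ← pow_succ]

theorem width_tail (hy : IsWindowFP dl dr γ ε W y) (hγ : 2 ≤ γ) (hε : 0 ≤ ε ∧ ε ≤ 1)
    (hdl : 3 ≤ dl) (hdr : 2 ≤ dr) {δ : ℝ} (hδ : 0 < δ) {i j : ℤ}
    (hij : i ≤ j) (hi : δ < y i) (hj : y j ≤ deltaZero dl dr / 2) :
    (j : ℝ) - i ≤ ((γ : ℝ) - 1) *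
      (1 / Real.log 2 * Real.log (Real.log (Real.exp 1 * deltaZero dl dr / δ)) + 2) := by
  have hd0 := deltaZero_pos dl hdr
  set r : ℤ := (γ : ℤ) - 1 with hr
  have hr0 : 0 < r := by omega
  obtain ⟨t, ht⟩ := Int.eq_ofNat_of_zero_le (Int.ediv_nonneg (by omega : 0 ≤ j - i) hr0.le)
  have h1 := Int.emod_add_mul_ediv (j - i) r
  have h2 := Int.emod_lt_of_pos (j - i) hr0
  have h3 := Int.emod_nonneg (j - i) hr0.ne'
  rw [ht, mul_comm] at h1
  have h4 : δ < deltaZero dl dr * (1 / 2) ^ (2 ^ t) := by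
    calc δ < y i := hi
      _ ≤ y (j - t * r) := hy.mono (by omega)
      _ ≤ _ := hy.sub_mul_le (by omega) hε hdl hdr hj t
      -- Since dl - 1 ≥ 2, the exponent is at least 2^t; this is where 1 / log 2 comes from.
      _ ≤ _ := by
        refine mul_le_mul_of_nonneg_left ?_ hd0.le
        exact pow_le_pow_of_le_one (by norm_num) (by norm_num)
          (Nat.pow_le_pow_left (by omega) t)
  have hl2 := Real.log_two_gt_d9
  have h5 : 2 ^ t * Real.log 2 ≤ Real.log (Real.exp 1 * deltaZero dl dr / δ) := by
    have := Real.log_lt_log hδ h4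
    rw [Real.log_mul hd0.ne' (by positivity), Real.log_pow, one_div, Real.log_inv] at this
    rw [Real.log_div (by positivity) hδ.ne', Real.log_mul (by positivity) hd0.ne', Real.log_exp]
    push_cast at this
    linarith
  have h6 : t * Real.log 2 + Real.log (Real.log 2) ≤
      Real.log (Real.log (Real.exp 1 * deltaZero dl dr / δ)) := by
    have := Real.log_le_log (by positivity) h5
    rwa [Real.log_mul (by positivity) (by positivity), Real.log_pow] at this
  have h7 : -Real.log 2 ≤ Real.log (Real.log 2) := by
    rw [← Real.log_inv]
    exact Real.log_le_log (by norm_num) (by linarith)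
  have h8 : (t : ℝ) + 1 ≤
      1 / Real.log 2 * Real.log (Real.log (Real.exp 1 * deltaZero dl dr / δ)) + 2 := by
    have : (t : ℝ) - 1 ≤ Real.log (Real.log (Real.exp 1 * deltaZero dl dr / δ)) / Real.log 2 := by
      rw [le_div_iff₀ (by linarith)]; linarith
    rw [one_div_mul_eq_div]; linarith
  have h9 : j - i ≤ r * ((t : ℤ) + 1) := by linarith
  have h10 : (j : ℝ) - i ≤ ((γ : ℝ) - 1) * (t + 1) := by
    have := (Int.cast_le (R := ℝ)).2 h9
    rw [hr] at this
    push_cast at this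
    exact this
  refine h10.trans (mul_le_mul_of_nonneg_left h8 ?_)
  have : (2 : ℝ) ≤ γ := by exact_mod_cast hγ
  linarith

/-! ### The neighbourhood of the expanding fixed point -/

/-- Here the distance from p is 1 - y/p, because Jensen for the concave `checkFn` bounds `y` above
by f of its double average, without logarithms. Being decreasing, it is read from right to left. -/
theorem width_below (hy : IsWindowFP dl dr γ ε W y) (hγ : 0 < γ) (hε : 0 < ε)
    (hdr : 2 ≤ dr) {p β κ : ℝ} (hβ : 0 < β) (hp1 : p ≤ 1)
    (hκ1 : 1 < κ) (hκ2 : κ ≤ 2) (hfix : ε * checkFn (dr - 1) p ^ (dl - 1) = p)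
    (hexp : ∀ c, 0 < c → c ≤ p → κ * (Real.log p - Real.log c) ≤
      ((dl - 1 : ℕ) : ℝ) * (Real.log (checkFn (dr - 1) p) - Real.log (checkFn (dr - 1) c)))
    {i j : ℤ} (hi : β ≤ y i) (hj : y j < p) :
    (j : ℝ) - i ≤ 3 * γ + (1 + β * (κ - 1)) * γ / (β * (κ - 1)) := by
  have hn : 1 ≤ dr - 1 := by omega
  have hβκ : 0 < β * (κ - 1) := mul_pos hβ (by linarith)
  by_cases hlen : j - i < 2 * γ
  · have h1 : (j : ℝ) - i < 2 * γ := by exact_mod_cast hlen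
    have h2 : 0 ≤ (1 + β * (κ - 1)) * γ / (β * (κ - 1)) := by positivity
    have h3 : (0 : ℝ) ≤ γ := by positivity
    linarith
  obtain ⟨N, hN⟩ := Int.eq_ofNat_of_zero_le (by omega : 0 ≤ j - i - 2 * γ)
  have hp0 : 0 < p := (hy.mem j).1.trans_lt hj
  have hi1 : 1 ≤ i := hy.one_le (hβ.trans_le hi)
  have hjW : j ≤ W := hy.le_window (hj.trans_le hp1)
  set z : ℤ → ℝ := fun k => y (0 - k) with hz
  have key := length_le_of_mul_mean_le hγ (κ := 1 + β * (κ - 1)) (by linarith)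
    (u := fun k => 1 - p⁻¹ * z k) (a := -j) (N := N) ?_ ?_ ?_
  · rw [add_sub_cancel_left] at key
    have h1 : (j : ℝ) - i - 2 * γ = N := by exact_mod_cast hN
    linarith
  · intro k l _ hkl _
    have : z l ≤ z k := hy.mono (by omega)
    have := mul_le_mul_of_nonneg_left this (inv_pos.2 hp0).le
    linarith
  · intro k hk _
    have h1 : z k < p := (hy.mono (by omega : 0 - k ≤ j)).trans_lt hj
    have := mul_lt_mul_of_pos_left h1 (inv_pos.2 hp0)
    rw [inv_mul_cancel₀ hp0.ne'] at this
    linarith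
  · intro k hk1 hk2
    simp only [mean_const_sub hγ, mean_const_mul]
    set c := mean γ fun l => mean γ fun l' => z (k + (l : ℤ) - (l' : ℤ)) with hc
    have hcβ : β ≤ c := le_mean hγ fun l hl => le_mean hγ fun l' hl' =>
      hi.trans (hy.mono (by omega))
    have hcp : c ≤ p := mean_le hγ fun l hl => mean_le hγ fun l' hl' =>
      (hy.mono (by omega : 0 - (k + (l : ℤ) - (l' : ℤ)) ≤ j)).trans hj.le
    have hc0 : 0 < c := hβ.trans_le hcβ
    have hc1 : c ≤ 1 := hcp.trans hp1
    have hzk : z k ≤ ε * checkFn (dr - 1) c ^ (dl - 1) := by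
      have h1 : z k = ε * coupledG dl dr γ z k := by
        rw [hz, coupledG_reflect dl dr hγ]
        exact hy.eq _ (by omega) (by omega)
      rw [h1, coupledG_eq _ _ hγ]
      have hm1 : ∀ l : ℕ, (mean γ fun l' => z (k + (l : ℤ) - (l' : ℤ))) ≤ 1 :=
        fun l => mean_le hγ fun l' _ => (hy.mem _).2
      refine mul_le_mul_of_nonneg_left (pow_le_pow_left₀ (le_mean hγ fun l _ =>
        checkFn_nonneg _ (le_mean hγ fun l' _ => (hy.mem _).1) (hm1 l)) ?_ _) hε.le
      exact mean_checkFn_le hγ _ fun l _ => hm1 l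
    have hcφ := checkFn_pos hn hc0 hc1
    -- Expansion by κ in logarithmic coordinates, exponentiated.
    have hpow : p⁻¹ * (ε * checkFn (dr - 1) c ^ (dl - 1)) ≤ (p⁻¹ * c) ^ κ := by
      have hpos : 0 < p⁻¹ * (ε * checkFn (dr - 1) c ^ (dl - 1)) := by positivity
      rw [Real.rpow_def_of_pos (by positivity), ← Real.log_le_iff_le_exp hpos,
        Real.log_mul (by positivity) (by positivity), log_mul_pow hε hcφ,
        Real.log_mul (by positivity) hc0.ne', Real.log_inv]
      have h1 := hexp c hc0 hcp
      have h2 : Real.log ε + ((dl - 1 : ℕ) : ℝ) * Real.log (checkFn (dr - 1) p) = Real.log p := by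
        rw [← log_mul_pow hε (checkFn_pos hn hp0 hp1), hfix]
      linarith
    have hw0 : 0 < p⁻¹ * c := by positivity
    have hw1 : p⁻¹ * c ≤ 1 := by rw [inv_mul_le_iff₀ hp0]; linarith
    have hwβ : β ≤ p⁻¹ * c :=
      hcβ.trans (le_mul_of_one_le_left hc0.le (by exact (one_le_inv₀ hp0).2 hp1))
    -- Bernoulli's inequality for the exponent κ - 1 ≤ 1. With w = c/p ≥ β it gives 1 - w^κ ≥ (1 +
    -- β(κ-1))(1 - w), hence the smaller factor used in the length bound.
    have hbern : (p⁻¹ * c) ^ κ ≤ p⁻¹ * c * (1 + (κ - 1) * (p⁻¹ * c - 1)) := by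
      have h1 : (p⁻¹ * c) ^ κ = p⁻¹ * c * (p⁻¹ * c) ^ (κ - 1) := by
        rw [← Real.rpow_one_add' hw0.le (by linarith)]; congr 1; ring
      have h2 := rpow_one_add_le_one_add_mul_self (s := p⁻¹ * c - 1) (by linarith)
        (p := κ - 1) (by linarith) (by linarith)
      rw [add_sub_cancel] at h2
      rw [h1]
      exact mul_le_mul_of_nonneg_left h2 hw0.le
    have h1 : p⁻¹ * z k ≤ p⁻¹ * (ε * checkFn (dr - 1) c ^ (dl - 1)) :=
      mul_le_mul_of_nonneg_left hzk (inv_pos.2 hp0).le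
    have h2 : 0 ≤ (p⁻¹ * c - β) * ((κ - 1) * (1 - p⁻¹ * c)) :=
      mul_nonneg (by linarith) (mul_nonneg (by linarith) (by linarith))
    linarith

/-- Above p the distance is log y - log p. Jensen for the logarithm, at both averages, bounds it
below by κ times its double average. -/
theorem width_above (hy : IsWindowFP dl dr γ ε W y) (hγ : 0 < γ) (hε : 0 < ε)
    (hdr : 2 ≤ dr) {p α κ : ℝ} (hp0 : 0 < p) (hα1 : α ≤ 1)
    (hκ1 : 1 < κ) (hfix : ε * checkFn (dr - 1) p ^ (dl - 1) = p)
    (hexp : ∀ c, p ≤ c → c ≤ α → κ * (Real.log c - Real.log p) ≤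
      ((dl - 1 : ℕ) : ℝ) * (Real.log (checkFn (dr - 1) c) - Real.log (checkFn (dr - 1) p)))
    {i j : ℤ} (hi : p < y i) (hj : y j < α) :
    (j : ℝ) - i ≤ 3 * γ + κ * γ / (κ - 1) := by
  have hn : 1 ≤ dr - 1 := by omega
  by_cases hlen : j - i < 2 * γ
  · have h1 : (j : ℝ) - i < 2 * γ := by exact_mod_cast hlen
    have h2 : 0 ≤ κ * γ / (κ - 1) :=
      div_nonneg (mul_nonneg (by linarith) (by positivity)) (by linarith)
    have h3 : (0 : ℝ) ≤ γ := by positivity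
    linarith
  obtain ⟨N, hN⟩ := Int.eq_ofNat_of_zero_le (by omega : 0 ≤ j - i - 2 * γ)
  have hi1 : 1 ≤ i := hy.one_le (hp0.trans hi)
  have hjW : j ≤ W := hy.le_window (hj.trans_le hα1)
  have hpα : p ≤ α := (hi.trans_le (hy.mono (by omega : i ≤ j))).le.trans hj.le
  have key := length_le_of_mul_mean_le hγ hκ1
    (u := fun k => Real.log (y k) - Real.log p) (a := i) (N := N) ?_ ?_ ?_
  · have h1 : (j : ℝ) - i - 2 * γ = N := by exact_mod_cast hN
    linarith
  · intro k l hk hkl _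
    have h1 := Real.log_le_log (hp0.trans (hi.trans_le (hy.mono hk))) (hy.mono hkl)
    linarith
  · intro k hk _
    exact sub_pos.2 (Real.log_lt_log hp0 (hi.trans_le (hy.mono hk)))
  · intro k hk1 hk2
    have hge : ∀ l : ℕ, l < γ → ∀ l' : ℕ, l' < γ → p ≤ y (k + (l : ℤ) - (l' : ℤ)) :=
      fun l hl l' hl' => hi.le.trans (hy.mono (by omega))
    set a : ℕ → ℝ := fun l => mean γ fun l' => y (k + (l : ℤ) - (l' : ℤ)) with ha
    have hap : ∀ l < γ, p ≤ a l := fun l hl => le_mean hγ fun l' hl' => hge l hl l' hl'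
    have haα : ∀ l < γ, a l ≤ α := fun l hl => mean_le hγ fun l' hl' =>
      (hy.mono (by omega : k + (l : ℤ) - (l' : ℤ) ≤ j)).trans hj.le
    have hφp : 0 < checkFn (dr - 1) p := checkFn_pos hn hp0 (hpα.trans hα1)
    have hφ : ∀ l < γ, checkFn (dr - 1) p ≤ checkFn (dr - 1) (a l) := fun l hl =>
      checkFn_mono _ ((haα l hl).trans hα1) (hap l hl)
    have hs0 : 0 < mean γ fun l => checkFn (dr - 1) (a l) := hφp.trans_le (le_mean hγ hφ)
    have hyk : Real.log (y k) = Real.log ε +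
        ((dl - 1 : ℕ) : ℝ) * Real.log (mean γ fun l => checkFn (dr - 1) (a l)) := by
      rw [← log_mul_pow hε hs0, hy.eq k (by omega) (by omega), coupledG_eq _ _ hγ]
    have hlp : Real.log p = Real.log ε +
        ((dl - 1 : ℕ) : ℝ) * Real.log (checkFn (dr - 1) p) := by
      rw [← log_mul_pow hε hφp, hfix]
    have h1 : mean γ (fun l => κ * mean γ fun l' =>
        (Real.log (y (k + (l : ℤ) - (l' : ℤ))) - Real.log p)) ≤
        mean γ (fun l => ((dl - 1 : ℕ) : ℝ) * Real.log (checkFn (dr - 1) (a l)) +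
          -(((dl - 1 : ℕ) : ℝ) * Real.log (checkFn (dr - 1) p))) := by
      refine mean_mono fun l hl => ?_
      have h2 : (mean γ fun l' => (Real.log (y (k + (l : ℤ) - (l' : ℤ))) - Real.log p)) ≤
          Real.log (a l) - Real.log p := by
        simp only [sub_eq_add_neg, mean_add, mean_const hγ]
        have := mean_log_le hγ hp0 fun l' hl' => hge l hl l' hl'
        simp only [sub_eq_add_neg] at this
        simp only [ha, sub_eq_add_neg]
        linarith
      have h3 := mul_le_mul_of_nonneg_left h2 (by linarith : 0 ≤ κ)
      have h4 := hexp (a l) (hap l hl) (haα l hl)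
      linarith
    rw [mean_const_mul, mean_add, mean_const_mul, mean_const hγ] at h1
    have h5 := mul_le_mul_of_nonneg_left (mean_log_le hγ hφp hφ)
      (Nat.cast_nonneg (dl - 1) : (0 : ℝ) ≤ _)
    linarith

theorem width_level (hy : IsWindowFP dl dr γ ε W y) (hγ : 0 < γ) (hε0 : 0 ≤ ε)
    (hε : ε < bpThresholdCoupled dl dr γ) {p : ℝ} (hp0 : 0 < p) (hp1 : p < 1)
    {i j : ℤ} (hi : y i = p) (hj : y j = p) : (j : ℝ) - i ≤ 2 * γ := by
  by_contra! hlt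
  have h1 : 2 * (γ : ℤ) < j - i := by exact_mod_cast hlt
  have hall : ∀ k, i ≤ k → k ≤ j → y k = p := fun k hk1 hk2 =>
    le_antisymm (hj ▸ hy.mono hk2) (hi ▸ hy.mono hk1)
  have hc : y (i + γ) = p := hall _ (by omega) (by omega)
  have h2 := hy.mul_pow_le hγ hε0 (i := i + γ) (hc ▸ hp0) (hy.le_window (hc ▸ hp1))
  rw [hall _ (by omega) (by omega), hall _ (by omega) (by omega)] at h2
  exact hε.not_ge (le_of_mul_le_mul_right h2 (pow_pos hp0 _))

/-! ### The contraction region -/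

/-- A bound on the ratios of neighbouring values survives averaging, and the uncoupled map contracts
it by q in the logarithm. Each application reads less than γ sections to either side, so t of them
need a margin of tγ. -/
theorem log_succ_sub_log_le (hy : IsWindowFP dl dr γ ε W y) (hγ : 0 < γ) (hε : 0 < ε)
    (hdl : 2 ≤ dl) (hdr : 2 ≤ dr) {α q M : ℝ} (hα0 : 0 < α) (hq0 : 0 ≤ q)
    (hM : Real.log (1 / α) ≤ M)
    (hcontr : ∀ a b, α ≤ a → a ≤ b → b ≤ 1 →
        ((dl - 1 : ℕ) : ℝ) * (Real.log (checkFn (dr - 1) b) - Real.log (checkFn (dr - 1) a)) ≤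
          q * (Real.log b - Real.log a))
    {i j : ℤ} (hi : α ≤ y i) (hj : j ≤ W) (t : ℕ) (k : ℤ) (hk1 : i + t * γ ≤ k)
    (hk2 : k + t * γ + 1 ≤ j) : Real.log (y (k + 1)) - Real.log (y k) ≤ q ^ t * M := by
  have hn : 1 ≤ dr - 1 := by omega
  have hi1 : 1 ≤ i := hy.one_le (hα0.trans_le hi)
  have hge : ∀ k, i ≤ k → α ≤ y k := fun k hk => hi.trans (hy.mono hk)
  induction t generalizing k with
  | zero =>
    have h1 := Real.log_le_log hα0 (hge k (by omega))
    have h2 := Real.log_nonpos (hy.mem (k + 1)).1 (hy.mem (k + 1)).2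
    rw [one_div, Real.log_inv] at hM
    rw [pow_zero, one_mul]
    linarith
  | succ t ih =>
    push_cast [add_mul] at hk1 hk2
    have htγ : 0 ≤ (t : ℤ) * γ := by positivity
    set η := q ^ t * M with hη
    have hm0 : (0 : ℝ) < ((dl - 1 : ℕ) : ℝ) := by exact_mod_cast (by omega : 0 < dl - 1)
    set a : ℤ → ℕ → ℝ := fun k l => mean γ fun l' => y (k + (l : ℤ) - (l' : ℤ)) with ha
    have haα : ∀ k' l, k ≤ k' → l < γ → α ≤ a k' l := fun k' l hk' hl =>
      le_mean hγ fun l' hl' => hge _ (by omega)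
    have ha1 : ∀ k l, a k l ≤ 1 := fun k l => mean_le hγ fun l' _ => (hy.mem _).2
    have hamono : ∀ l, a k l ≤ a (k + 1) l := fun l => mean_mono fun l' _ => hy.mono (by omega)
    have hastep : ∀ l < γ, Real.log (a (k + 1) l) - Real.log (a k l) ≤ η := by
      intro l hl
      have hak := hα0.trans_le (haα k l le_rfl hl)
      have h1 : a (k + 1) l ≤ Real.exp η * a k l := by
        simp only [ha]
        rw [← mean_const_mul]
        refine mean_mono fun l' hl' => ?_
        have h2 := ih (k + (l : ℤ) - (l' : ℤ)) (by omega) (by omega)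
        have p1 := hα0.trans_le (hge (k + (l : ℤ) - (l' : ℤ)) (by omega))
        have p2 := hα0.trans_le (hge (k + (l : ℤ) - (l' : ℤ) + 1) (by omega))
        have e : k + 1 + (l : ℤ) - (l' : ℤ) = k + (l : ℤ) - (l' : ℤ) + 1 := by ring
        rw [e, ← Real.log_le_log_iff p2 (by positivity), Real.log_mul (by positivity) p1.ne',
          Real.log_exp]
        linarith
      have h3 := Real.log_le_log (hα0.trans_le (haα (k + 1) l (by omega) hl)) h1
      rw [Real.log_mul (by positivity) hak.ne', Real.log_exp] at h3
      linarith
    have hφ0 : ∀ k', k ≤ k' → ∀ l < γ, 0 < checkFn (dr - 1) (a k' l) := fun k' hk' l hl =>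
      checkFn_pos hn (hα0.trans_le (haα k' l hk' hl)) (ha1 _ _)
    have hs0 : ∀ k', k ≤ k' → 0 < mean γ fun l => checkFn (dr - 1) (a k' l) := fun k' hk' =>
      (checkFn_pos hn hα0 ((haα k' 0 hk' hγ).trans (ha1 _ _))).trans_le
        (le_mean hγ fun l hl => checkFn_mono _ (ha1 _ _) (haα k' l hk' hl))
    have hs : (mean γ fun l => checkFn (dr - 1) (a (k + 1) l)) ≤
        Real.exp (q * η / ((dl - 1 : ℕ) : ℝ)) * mean γ fun l => checkFn (dr - 1) (a k l) := by
      rw [← mean_const_mul]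
      refine mean_mono fun l hl => ?_
      have p1 := hφ0 k le_rfl l hl
      rw [← Real.log_le_log_iff (hφ0 (k + 1) (by omega) l hl) (by positivity),
        Real.log_mul (by positivity) p1.ne', Real.log_exp]
      have h1 := hcontr _ _ (haα k l le_rfl hl) (hamono l) (ha1 _ _)
      have h2 := mul_le_mul_of_nonneg_left (hastep l hl) hq0
      have h3 : Real.log (checkFn (dr - 1) (a (k + 1) l)) - Real.log (checkFn (dr - 1) (a k l)) ≤
          q * η / ((dl - 1 : ℕ) : ℝ) := by
        rw [le_div_iff₀' hm0]; linarith
      linarith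
    have hlogy : ∀ k', k ≤ k' → k' ≤ k + 1 → Real.log (y k') = Real.log ε +
        ((dl - 1 : ℕ) : ℝ) * Real.log (mean γ fun l => checkFn (dr - 1) (a k' l)) := by
      intro k' hk1' hk2'
      rw [← log_mul_pow hε (hs0 k' hk1'), hy.eq k' (by omega) (by omega), coupledG_eq _ _ hγ]
    have h4 := Real.log_le_log (hs0 (k + 1) (by omega)) hs
    rw [Real.log_mul (by positivity) (hs0 k le_rfl).ne', Real.log_exp] at h4
    have h5 := mul_le_mul_of_nonneg_left h4 hm0.le
    rw [mul_add, mul_div_cancel₀ _ hm0.ne'] at h5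
    rw [hlogy k le_rfl (by omega), hlogy (k + 1) (by omega) le_rfl, pow_succ', mul_assoc]
    linarith

/-- Near the middle of the stretch the increments of log y are smallest, of order q^t, while
`mul_pow_le` bounds their sum over 2γ sections below by a multiple of Δε. -/
theorem width_contraction (hy : IsWindowFP dl dr γ ε W y) (hγ : 0 < γ) (hε0 : 0 < ε)
    (hε : ε < bpThresholdCoupled dl dr γ)
    (hdl : 2 ≤ dl) (hdr : 2 ≤ dr) {α q M : ℝ} (hα0 : 0 < α) (hq0 : 0 < q) (hq1 : q < 1)
    (hM : Real.log (1 / α) ≤ M) (hM0 : 0 < M)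
    (hcontr : ∀ a b, α ≤ a → a ≤ b → b ≤ 1 →
        ((dl - 1 : ℕ) : ℝ) * (Real.log (checkFn (dr - 1) b) - Real.log (checkFn (dr - 1) a)) ≤
          q * (Real.log b - Real.log a))
    {i j : ℤ} (hij : i ≤ j) (hi : α ≤ y i) (hj : j ≤ W) :
    (j : ℝ) - i ≤ 2 * γ * (2 + (|Real.log (2 * γ * ((dl - 1 : ℕ) : ℝ) * M)| +
      Real.log (1 / (bpThresholdCoupled dl dr γ - ε))) / Real.log (1 / q)) := by
  have hγ' : (0 : ℝ) < γ := by exact_mod_cast hγ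
  set Δ := bpThresholdCoupled dl dr γ - ε with hΔ
  have hΔ0 : 0 < Δ := sub_pos.2 hε
  have hΔ1 : Δ ≤ 1 := by linarith [bpThresholdCoupled_le_one dl dr γ]
  have hlΔ : 0 ≤ Real.log (1 / Δ) := Real.log_nonneg ((one_le_div hΔ0).2 hΔ1)
  have hlq : 0 < Real.log (1 / q) := Real.log_pos ((one_lt_div hq0).2 hq1)
  have hge : ∀ k, i ≤ k → α ≤ y k := fun k hk => hi.trans (hy.mono hk)
  have hg0 : (0 : ℤ) < 2 * γ := by omega
  obtain ⟨T, hT⟩ := Int.eq_ofNat_of_zero_le (Int.ediv_nonneg (by omega : 0 ≤ j - i) hg0.le)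
  have h1 := Int.emod_add_mul_ediv (j - i) (2 * γ)
  have h2 := Int.emod_lt_of_pos (j - i) hg0
  have h3 := Int.emod_nonneg (j - i) hg0.ne'
  rw [hT] at h1
  have hlen : (j : ℝ) - i ≤ 2 * γ * (T + 1) := by
    have : j - i ≤ 2 * γ * ((T : ℤ) + 1) := by linarith
    exact_mod_cast this
  refine hlen.trans (mul_le_mul_of_nonneg_left ?_ (by positivity))
  rcases T with _ | t
  · have : 0 ≤ (|Real.log (2 * γ * ((dl - 1 : ℕ) : ℝ) * M)| + Real.log (1 / Δ)) /
      Real.log (1 / q) := by positivity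
    push_cast
    linarith
  suffices h : (t : ℝ) ≤ (|Real.log (2 * γ * ((dl - 1 : ℕ) : ℝ) * M)| + Real.log (1 / Δ)) /
      Real.log (1 / q) by
    push_cast
    linarith
  rw [le_div_iff₀ hlq]
  -- the section in the middle
  set c := i + (t + 1) * γ with hc
  have htγ : 0 ≤ (t : ℤ) * γ := by positivity
  have hcexp : c = i + t * γ + γ := by rw [hc]; ring
  have hjexp : i + 2 * (t * γ) + 2 * γ ≤ j := by
    push_cast at h1
    linarith
  have hstep : ∀ s : ℕ, s ≤ 2 * γ →
      Real.log (y (c - γ + s)) - Real.log (y (c - γ)) ≤ s * (q ^ t * M) := by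
    intro s
    induction s with
    | zero => intro _; simp
    | succ s ih =>
      intro hs
      have h4 := ih (by omega)
      have h5 := hy.log_succ_sub_log_le hγ hε0 hdl hdr hα0 hq0.le hM hcontr hi hj t
        (c - γ + s) (by omega) (by omega)
      push_cast
      rw [← add_assoc]
      linarith
  have h6 := hstep (2 * γ) le_rfl
  have e6 : c - γ + ((2 * γ : ℕ) : ℤ) = c + γ := by push_cast; ring
  rw [e6] at h6
  have hcpos : ∀ k, i ≤ k → 0 < y k := fun k hk => hα0.trans_le (hge k hk)
  have h7 := hy.mul_pow_le hγ hε0.le (hcpos c (by omega)) (by omega)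
  have hεs : 0 < bpThresholdCoupled dl dr γ := hε0.trans hε
  have p1 := hcpos (c - γ) (by omega)
  have p2 := hcpos (c + γ) (by omega)
  have h8 := Real.log_le_log (by positivity) h7
  rw [log_mul_pow hεs p1, log_mul_pow hε0 p2] at h8
  have hm0 : (0 : ℝ) < ((dl - 1 : ℕ) : ℝ) := by exact_mod_cast (by omega : 0 < dl - 1)
  -- From log s ≤ s - 1 at the ratio of the two rates, the threshold being at most 1.
  have h9 : Δ ≤ Real.log (bpThresholdCoupled dl dr γ) - Real.log ε := by
    have h10 := Real.log_le_sub_one_of_pos (div_pos hε0 hεs)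
    rw [Real.log_div hε0.ne' hεs.ne'] at h10
    have h11 : Δ ≤ Δ / bpThresholdCoupled dl dr γ :=
      le_div_self hΔ0.le hεs (bpThresholdCoupled_le_one dl dr γ)
    have h12 : Δ / bpThresholdCoupled dl dr γ = 1 - ε / bpThresholdCoupled dl dr γ := by
      rw [hΔ, sub_div, div_self hεs.ne']
    linarith
  have h13 : Δ ≤ 2 * γ * ((dl - 1 : ℕ) : ℝ) * M * q ^ t := by
    have := mul_le_mul_of_nonneg_left h6 hm0.le
    push_cast at this
    linarith
  have h14 := Real.log_le_log hΔ0 h13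
  rw [Real.log_mul (by positivity) (by positivity), Real.log_pow] at h14
  rw [one_div, one_div, Real.log_inv, Real.log_inv]
  linarith [le_abs_self (Real.log (2 * γ * ((dl - 1 : ℕ) : ℝ) * M))]

end IsWindowFP

/-! ### Adding up the five ranges of values -/

theorem mul_pow_half_deltaZero_lt {dl dr : ℕ} (hdl : 3 ≤ dl) (hdr : 2 ≤ dr) {ε : ℝ}
    (hε : 0 ≤ ε ∧ ε ≤ 1) {x : ℝ} (hx0 : 0 < x) (hx : x ≤ deltaZero dl dr / 2) :
    ε * checkFn (dr - 1) x ^ (dl - 1) < x := by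
  have hd0 := deltaZero_pos dl hdr
  have hx1 : x ≤ 1 := by linarith [deltaZero_le_one hdl hdr]
  have h1 : checkFn (dr - 1) x ^ (dl - 1) ≤ (((dr - 1 : ℕ) : ℝ) * x) ^ (dl - 1) :=
    pow_le_pow_left₀ (checkFn_nonneg _ hx0.le hx1) (checkFn_le_mul _ hx1) _
  have h2 : (((dr - 1 : ℕ) : ℝ) * x) ^ (dl - 1) < x := by
    set θ := x / deltaZero dl dr with hθ
    have hxθ : x = deltaZero dl dr * θ := by rw [hθ]; field_simp
    have hθ0 : 0 < θ := div_pos hx0 hd0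
    have hθ1 : θ < 1 := by rw [hθ, div_lt_one hd0]; linarith
    rw [hxθ, ← mul_assoc, mul_pow, mul_deltaZero_pow hdl hdr]
    exact mul_lt_mul_of_pos_left (pow_lt_self_of_lt_one₀ hθ0 hθ1 (by omega)) hd0
  exact (mul_le_of_le_one_left (pow_nonneg (checkFn_nonneg _ hx0.le hx1) _) hε.2).trans_lt
    (h1.trans_lt h2)

/-- The number of sections above `δ` in a window fixed point. -/
theorem exists_transitionWidth_le {dl dr γ : ℕ} (hdl : 3 ≤ dl) (hdr : 2 ≤ dr) (hγ : 2 ≤ γ)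
    {ε₀ : ℝ} (hε₀1 : ε₀ ≤ 1) (hε₀ : bpThresholdRegular dl dr < ε₀) :
    ∃ B C : ℝ, 0 < B ∧ 0 < C ∧ ∀ (W : ℕ) (ε δ : ℝ), ε₀ ≤ ε → ε < bpThresholdCoupled dl dr γ →
      0 < δ → δ ≤ deltaZero dl dr → (transitionWidth dl dr γ ε W δ : ℝ) ≤
        widthBound γ (1 / Real.log 2) B C (Real.exp 1 * deltaZero dl dr) δ
          (bpThresholdCoupled dl dr γ - ε) := by
  have hγ0 : 0 < γ := by omega
  have hγ2 : (2 : ℝ) ≤ γ := by exact_mod_cast hγ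
  have hγ' : (0 : ℝ) < γ := by linarith
  have hε₀0 : 0 < ε₀ := (bpThresholdRegular_nonneg dl dr).trans_lt hε₀
  obtain ⟨α, q, hα0, hα1, hq0, hq1, hαε, hcontr⟩ :=
    exists_contraction_level (by omega : 2 ≤ dl) hdr hε₀1 hε₀
  have hd0 := deltaZero_pos dl hdr
  have hd1 := deltaZero_le_one hdl hdr
  set β := deltaZero dl dr / 2 with hβ
  have hβ0 : 0 < β := by positivity
  have hβα : β < α := by
    by_contra! h
    exact hαε.not_gt (mul_pow_half_deltaZero_lt hdl hdr ⟨hε₀0.le, hε₀1⟩ hα0 h)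
  set κ₁ := 1 + Real.log (ε₀ * checkFn (dr - 1) α ^ (dl - 1) / α) / Real.log (1 / β) with hκ₁
  have hκ₁1 : 1 < κ₁ := by
    have h1 : 0 < Real.log (ε₀ * checkFn (dr - 1) α ^ (dl - 1) / α) :=
      Real.log_pos ((one_lt_div hα0).2 hαε)
    have h2 : 0 < Real.log (1 / β) := Real.log_pos ((one_lt_div hβ0).2 (by linarith))
    have := div_pos h1 h2
    linarith
  -- The cap at 2 is what Bernoulli's inequality in `width_below` requires.
  set κ := min κ₁ 2 with hκ
  have hκ1 : 1 < κ := lt_min hκ₁1 one_lt_two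
  have hκ2 : κ ≤ 2 := min_le_right _ _
  have hlq : 0 < Real.log (1 / q) := Real.log_pos ((one_lt_div hq0).2 hq1)
  -- The added 1 keeps M positive even if α = 1.
  set M := Real.log (1 / α) + 1 with hM
  have hM0 : 0 < M := by
    have := Real.log_nonneg ((one_le_div hα0).2 hα1)
    linarith
  set B := 2 * γ / Real.log (1 / q) with hB
  have hB0 : 0 < B := by positivity
  set C₁ := |Real.log (2 * γ * ((dl - 1 : ℕ) : ℝ) * M)| with hC₁
  set b₂ := 3 * γ + (1 + β * (κ - 1)) * γ / (β * (κ - 1)) with hb₂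
  set b₄ := 3 * γ + κ * γ / (κ - 1) with hb₄
  have hκ' : 0 < κ - 1 := by linarith
  have hb₂0 : 0 < b₂ := by positivity
  have hb₄0 : 0 < b₄ := by positivity
  -- The 5 converts the five length bounds into cardinalities.
  set C' := 5 + b₂ + 2 * γ + b₄ + 2 * γ * (2 + C₁ / Real.log (1 / q)) with hC'
  have hC'0 : 0 < C' := by positivity
  refine ⟨B, 2 + C', hB0, by linarith, fun W ε δ hε1 hε2 hδ hδ₀ => ?_⟩
  have hε0 : 0 < ε := hε₀0.trans_le hε1
  have hεmem : 0 ≤ ε ∧ ε ≤ 1 := ⟨hε0.le, hε2.le.trans (bpThresholdCoupled_le_one dl dr γ)⟩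
  have hy := isWindowFP_fwFP dl dr γ hεmem W
  rw [transitionWidth]
  set y := fwFP dl dr γ ε W
  obtain ⟨p, hβp, hpα, hfix, hlow, hhigh⟩ := exists_expanding_fixedPoint (m := dl - 1)
    (by omega : 1 ≤ dr - 1) hε₀0 hε1 hβ0 hβα hα1
    (mul_pow_half_deltaZero_lt hdl hdr hεmem hβ0 le_rfl) hαε
  have hp0 := hβ0.trans hβp
  rw [← hκ₁] at hlow hhigh
  set Δ := bpThresholdCoupled dl dr γ - ε with hΔ
  have hΔ0 : 0 < Δ := sub_pos.2 hε2
  have hlΔ : 0 ≤ Real.log (1 / Δ) := by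
    refine Real.log_nonneg ((one_le_div hΔ0).2 ?_)
    linarith [bpThresholdCoupled_le_one dl dr γ]
  set b₁ := ((γ : ℝ) - 1) *
      (1 / Real.log 2 * Real.log (Real.log (Real.exp 1 * deltaZero dl dr / δ)) + 2) with hb₁
  set b₅ := 2 * γ * (2 + (C₁ + Real.log (1 / Δ)) / Real.log (1 / q)) with hb₅
  have hb₅0 : 0 ≤ b₅ := by positivity
  -- The factor e in D makes the inner logarithm at least 1 for every δ ≤ δ₀.
  have hLL : 0 ≤ Real.log (Real.log (Real.exp 1 * deltaZero dl dr / δ)) := by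
    refine Real.log_nonneg ?_
    rw [Real.le_log_iff_exp_le (by positivity), le_div_iff₀ hδ]
    exact mul_le_mul_of_nonneg_left hδ₀ (Real.exp_pos 1).le
  have hb₁0 : 0 ≤ b₁ := mul_nonneg (by linarith) (by positivity)
  obtain ⟨f₁, c₁⟩ := ncard_le_of_sub_le (S := {i : ℤ | δ < y i ∧ y i ≤ β}) hb₁0
    fun i hi j hj hij => hy.width_tail hγ hεmem hdl hdr hδ hij hi.1 hj.2
  obtain ⟨f₂, c₂⟩ := ncard_le_of_sub_le (S := {i : ℤ | β ≤ y i ∧ y i < p}) hb₂0.le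
    fun i hi j hj _ => hy.width_below hγ0 hε0 hdr hβ0 (hpα.le.trans hα1) hκ1 hκ2 hfix
      (fun c hc hcp => (mul_le_mul_of_nonneg_right (min_le_left _ _)
        (sub_nonneg.2 (Real.log_le_log hc hcp))).trans (hlow c hc hcp)) hi.1 hj.2
  obtain ⟨f₃, c₃⟩ := ncard_le_of_sub_le (S := {i : ℤ | y i = p}) (b := 2 * γ) (by positivity)
    fun i hi j hj _ => hy.width_level hγ0 hε0.le hε2 hp0 (hpα.trans_le hα1) hi hj
  obtain ⟨f₄, c₄⟩ := ncard_le_of_sub_le (S := {i : ℤ | p < y i ∧ y i < α}) hb₄0.le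
    fun i hi j hj _ => hy.width_above hγ0 hε0 hdr hp0 hα1 hκ1 hfix
      (fun c hc hcp => (mul_le_mul_of_nonneg_right (min_le_left _ _)
        (sub_nonneg.2 (Real.log_le_log hp0 hc))).trans (hhigh c hc hcp)) hi.1 hj.2
  -- Only this range has to be cut off at W, since `y` equals 1 beyond the window.
  obtain ⟨f₅, c₅⟩ := ncard_le_of_sub_le (S := {i : ℤ | α ≤ y i ∧ i ≤ W}) hb₅0
    fun i hi j hj hij => hy.width_contraction hγ0 hε0 hε2 (by omega) hdr hα0 hq0 hq1
      (by linarith) hM0 hcontr hij hi.1 hj.2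
  set S₁ := {i : ℤ | δ < y i ∧ y i ≤ β}
  set S₂ := {i : ℤ | β ≤ y i ∧ y i < p}
  set S₃ := {i : ℤ | y i = p}
  set S₄ := {i : ℤ | p < y i ∧ y i < α}
  set S₅ := {i : ℤ | α ≤ y i ∧ i ≤ W}
  have hsub : {i : ℤ | (1 ≤ i ∧ i ≤ (W : ℤ)) ∧ δ < y i ∧ y i ≤ 1} ⊆
      S₁ ∪ (S₂ ∪ (S₃ ∪ (S₄ ∪ S₅))) := by
    rintro i ⟨⟨_, hi⟩, hδi, _⟩
    rcases le_or_gt (y i) β with h1 | h1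
    · exact Or.inl ⟨hδi, h1⟩
    rcases lt_trichotomy (y i) p with h2 | h2 | h2
    · exact Or.inr (Or.inl ⟨h1.le, h2⟩)
    · exact Or.inr (Or.inr (Or.inl h2))
    rcases lt_or_ge (y i) α with h3 | h3
    · exact Or.inr (Or.inr (Or.inr (Or.inl ⟨h2, h3⟩)))
    · exact Or.inr (Or.inr (Or.inr (Or.inr ⟨h3, hi⟩)))
  have hcard := Set.ncard_le_ncard hsub (f₁.union (f₂.union (f₃.union (f₄.union f₅))))
  have u₁ := Set.ncard_union_le S₁ (S₂ ∪ (S₃ ∪ (S₄ ∪ S₅)))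
  have u₂ := Set.ncard_union_le S₂ (S₃ ∪ (S₄ ∪ S₅))
  have u₃ := Set.ncard_union_le S₃ (S₄ ∪ S₅)
  have u₄ := Set.ncard_union_le S₄ S₅
  have hnat := hcard.trans (by omega : _ ≤ S₁.ncard + S₂.ncard + S₃.ncard + S₄.ncard + S₅.ncard)
  have hreal := (Nat.cast_le (α := ℝ)).2 hnat
  push_cast at hreal
  have hb₅eq : b₅ = 2 * γ * (2 + C₁ / Real.log (1 / q)) + B * Real.log (1 / Δ) := by
    rw [hb₅, hB]; field_simp; ring
  have hrest : B * Real.log (1 / Δ) + C' ≤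
      ((γ : ℝ) - 1) * (B * Real.log (1 / Δ) + C') :=
    le_mul_of_one_le_left (by positivity) (by linarith)
  have hwb : widthBound γ (1 / Real.log 2) B (2 + C') (Real.exp 1 * deltaZero dl dr) δ Δ =
      b₁ + ((γ : ℝ) - 1) * (B * Real.log (1 / Δ) + C') := by
    rw [widthBound, hb₁]; ring
  rw [hwb]
  linarith

/-! ### From the transition width to the window threshold -/

/-- If y₁ > δ, monotonicity puts all W sections above δ and the width equals W. -/
theorem le_fwThreshold {dl dr γ W : ℕ} {ε δ : ℝ} (hε : 0 ≤ ε ∧ ε ≤ 1)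
    (h : transitionWidth dl dr γ ε W δ < W) : ε ≤ fwThreshold dl dr γ W δ := by
  refine le_csSup ⟨1, fun _ h => h.2.1⟩ ⟨hε.1, hε.2, ?_⟩
  by_contra! hlt
  have hy := isWindowFP_fwFP dl dr γ hε W
  have hset : {i : ℤ | (1 ≤ i ∧ i ≤ (W : ℤ)) ∧ δ < fwFP dl dr γ ε W i ∧ fwFP dl dr γ ε W i ≤ 1} =
      ((Finset.Icc 1 (W : ℤ) : Finset ℤ) : Set ℤ) := by
    ext i
    simp only [Set.mem_ofPred_eq, Finset.coe_Icc, Set.mem_Icc]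
    exact ⟨fun h => h.1, fun h => ⟨h, hlt.trans_le (hy.mono h.1), (hy.mem i).2⟩⟩
  rw [transitionWidth, hset, Set.ncard_coe_finset, Int.card_Icc] at h
  omega

/-- A lower bound on the window threshold from an upper bound on the transition width. -/
theorem fwThreshold_ge {dl dr γ W : ℕ} (hγ : 2 ≤ γ) {A B C D δ : ℝ} (hB : 0 < B)
    (hlt : bpThresholdRegular dl dr < bpThresholdCoupled dl dr γ)
    (hwidth : ∀ ε : ℝ, (bpThresholdCoupled dl dr γ + bpThresholdRegular dl dr) / 2 ≤ ε →
      ε < bpThresholdCoupled dl dr γ → (transitionWidth dl dr γ ε W δ : ℝ) ≤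
        widthBound γ A B C D δ (bpThresholdCoupled dl dr γ - ε))
    (hW : ⌊widthBound γ A B C D δ ((bpThresholdCoupled dl dr γ - bpThresholdRegular dl dr) / 2)⌋
      + 1 ≤ (W : ℤ)) :
    bpThresholdCoupled dl dr γ - Real.exp (-(1 / B) * ((W : ℝ) / ((γ : ℝ) - 1)
      - A * Real.log (Real.log (D / δ)) - C)) ≤ fwThreshold dl dr γ W δ := by
  have hγ2 : (2 : ℝ) ≤ γ := by exact_mod_cast hγ
  have hr : (0 : ℝ) < (γ : ℝ) - 1 := by linarith
  set E := Real.exp (-(1 / B) * ((W : ℝ) / ((γ : ℝ) - 1) - A * Real.log (Real.log (D / δ)) - C))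
    with hE
  set Δm := (bpThresholdCoupled dl dr γ - bpThresholdRegular dl dr) / 2 with hΔm
  have hΔm0 : 0 < Δm := by rw [hΔm]; linarith
  -- E is the value of Δ at which the width bound equals W.
  have hiff : ∀ Δ : ℝ, 0 < Δ → (widthBound γ A B C D δ Δ < W ↔ E < Δ) := by
    intro Δ hΔ
    rw [hE, ← Real.lt_log_iff_exp_lt hΔ, widthBound, ← lt_div_iff₀' hr, one_div Δ, Real.log_inv,
      neg_mul, neg_lt, one_div, lt_inv_mul_iff₀ hB]
    constructor <;> intro h <;> linarith
  have hWm : widthBound γ A B C D δ Δm < W := by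
    have h1 := Int.lt_floor_add_one (widthBound γ A B C D δ Δm)
    have h2 := (Int.cast_le (R := ℝ)).2 hW
    push_cast at h2
    linarith
  have hEm := (hiff Δm hΔm0).1 hWm
  refine le_of_forall_lt fun c hc => ?_
  -- The rate at distance Δ below the coupled threshold is then admissible, exceeds c, and has width
  -- below W.
  obtain ⟨Δ, h1, h2⟩ := exists_between
    (lt_min hEm (by linarith : E < bpThresholdCoupled dl dr γ - c))
  have hΔ0 : 0 < Δ := (Real.exp_pos _).trans h1
  have h3 := h2.trans_le (min_le_left _ _)
  have h4 := h2.trans_le (min_le_right _ _)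
  have hr0 := bpThresholdRegular_nonneg dl dr
  have hc1 := bpThresholdCoupled_le_one dl dr γ
  have hw := hwidth (bpThresholdCoupled dl dr γ - Δ) (by linarith) (by linarith)
  rw [sub_sub_cancel] at hw
  have hlt := hw.trans_lt ((hiff Δ hΔ0).2 h1)
  exact (by linarith : c < bpThresholdCoupled dl dr γ - Δ).trans_le
    (le_fwThreshold ⟨by linarith, by linarith⟩ (by exact_mod_cast hlt))

end SpatialCoupling

theorem proposition1 (dl dr γ : ℕ) (hdl : 3 ≤ dl) (hdr : 2 ≤ dr) (hγ : 2 ≤ γ) :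
    ∃ A B C D : ℝ, 0 < A ∧ 0 < B ∧ 0 < C ∧ SpatialCoupling.deltaZero dl dr < D ∧
      (∀ (W : ℕ) (ε δ : ℝ),
        (SpatialCoupling.bpThresholdCoupled dl dr γ
            + SpatialCoupling.bpThresholdRegular dl dr) / 2 ≤ ε →
        ε < SpatialCoupling.bpThresholdCoupled dl dr γ →
        0 < δ → δ ≤ SpatialCoupling.deltaZero dl dr →
        (SpatialCoupling.transitionWidth dl dr γ ε W δ : ℝ) ≤
          SpatialCoupling.widthBound γ A B C D δ
            (SpatialCoupling.bpThresholdCoupled dl dr γ - ε)) ∧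
      (SpatialCoupling.bpThresholdRegular dl dr < SpatialCoupling.bpThresholdCoupled dl dr γ →
        ∀ (W : ℕ) (δ : ℝ),
          0 < δ → δ ≤ SpatialCoupling.deltaZero dl dr →
          ⌊SpatialCoupling.widthBound γ A B C D δ
            ((SpatialCoupling.bpThresholdCoupled dl dr γ
              - SpatialCoupling.bpThresholdRegular dl dr) / 2)⌋ + 1 ≤ (W : ℤ) →
          SpatialCoupling.bpThresholdCoupled dl dr γ
            - Real.exp (-(1 / B) * ((W : ℝ) / ((γ : ℝ) - 1)
                - A * Real.log (Real.log (D / δ)) - C)) ≤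
          SpatialCoupling.fwThreshold dl dr γ W δ) := by
  have hd0 := SpatialCoupling.deltaZero_pos dl hdr
  rcases le_or_gt (SpatialCoupling.bpThresholdCoupled dl dr γ)
    (SpatialCoupling.bpThresholdRegular dl dr) with hle | hlt
  -- Without a gap between the thresholds both claims are vacuous, so any constants serve.
  · exact ⟨1, 1, 1, SpatialCoupling.deltaZero dl dr + 1, one_pos, one_pos, one_pos, by linarith,
      fun W ε δ h1 h2 => by linarith, fun h => absurd h hle.not_gt⟩
  obtain ⟨B, C, hB, hC, h⟩ := SpatialCoupling.exists_transitionWidth_le hdl hdr hγ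
    (ε₀ := (SpatialCoupling.bpThresholdCoupled dl dr γ
      + SpatialCoupling.bpThresholdRegular dl dr) / 2)
    (by linarith [SpatialCoupling.bpThresholdCoupled_le_one dl dr γ]) (by linarith)
  refine ⟨1 / Real.log 2, B, C, Real.exp 1 * SpatialCoupling.deltaZero dl dr,
    one_div_pos.2 (Real.log_pos one_lt_two), hB, hC,
    lt_mul_of_one_lt_left hd0 (Real.one_lt_exp_iff.2 one_pos), h, fun hlt W δ hδ hδ₀ hW => ?_⟩
  exact SpatialCoupling.fwThreshold_ge hγ hB hlt (fun ε h1 h2 => h W ε δ h1 h2 hδ hδ₀) hW
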